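/- **Setting.** An *instruction sequence* is a non-empty finite sequence of instructions, each of which is a plain basic instruction $a$, a positive test $+a$, a negative test $-a$, a forward jump $\#l$ ($l\in\mathbb N$), or the termination instruction $!$. Let $\mathit{IS}_{\mathrm{br}}$ be the set of instruction sequences whose basic instructions $a$ act on Boolean registers as follows: read an input register $\mathsf{in}{:}i$; read an auxiliary register $\mathsf{aux}{:}i$; write a Boolean value to an auxiliary register or to the output register $\mathsf{out}$. Reading replies the content of the register, writing replies the value written. Execution starts at the first instruction. After $a$ execution proceeds with the next instruction; after $+a$ (resp. $-a$) it does so if the reply is true (resp. false), and otherwise it skips one instruction; after $\#l$ it proceeds with the $l$-th next instruction; $!$ terminates. Execution becomes inactive at $\#0$ and when there is no instruction to proceed with. A sequence $X\in \mathit{IS}_{\mathrm{br}}$ *computes* $f:\{0,1\}^n\to\{0,1\}$ if there is an $l\in\mathbb N$ such that for all $b_1,\dots,b_n$, when only $\mathsf{in}{:}1,\dots,\mathsf{in}{:}n$ (containing $b_1,\dots,b_n$), $\mathsf{aux}{:}1,\dots,\mathsf{aux}{:}l$ and $\mathsf{out}$ (all initially false) are available, execution of $X$ terminates with $f(b_1,\dots,b_n)$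 in $\mathsf{out}$. Let $\mathrm{PLIS}$ be the class of all Boolean function families $(f_n)_{n\in\mathbb N}$, $f_n:\{0,1\}^n\to\{0,1\}$, for which there is a polynomial function $h:\mathbb N\to\mathbb N$ such that for every $n$ some $X\in \mathit{IS}_{\mathrm{br}}$ of length at most $h(n)$ computes $f_n$. Let $D(k)=\binom{2k}{1}+\binom{2k}{2}+\binom{2k}{3}$, and let $(\alpha_k)_{k\in\mathbb N}$ be any family of bijections from $\{1,\dots,D(k)\}$ onto the set of all sets of one, two or three literals over the variables $v_1,\dots,v_k$, such that $\alpha_{k+1}(j)=\alpha_k(j)$ for all $k$ and all $j\le D(k)$. For $n\in\mathbb N$ let $k$ be the unique number with $D(k)\le n<D(k+1)$; then $\mathrm{3SATC}_n(b_1,\dots,b_n)$ is true iff the formula $$\bigwedge_{i\le D(k),\ b_i=1}\ \bigvee \alpha_k(i)$$ is satisfiable. Let $\mathrm{3SATC}=(\mathrm{3SATC}_n)_{n\in\mathbb N}$. Let $\mathrm{3SAT}\subseteq\{0,1\}^*$ be the language of all (binary encoded) satisfiable CNF formulas with at most three literals per clause. Let $\mathrm{P/poly}$ be the class of languages decided by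 polynomial-size families of Boolean circuits, and $\mathrm{NP}$ the class of languages with polynomial-length certificates that are verifiable in polynomial time by a Turing machine. **Theorem.** The *non-uniform super-polynomial complexity conjecture* is the statement $\mathrm{3SATC}\notin\mathrm{PLIS}$. It is equivalent to the statement $\mathrm{3SAT}\notin\mathrm{P/poly}$, and it is equivalent to the statement $\mathrm{NP}\not\subseteq\mathrm{P/poly}$. That is, $$\mathrm{3SATC}\notin\mathrm{PLIS}\iff \mathrm{3SAT}\notin\mathrm{P/poly},\qquad \mathrm{3SATC}\notin\mathrm{PLIS}\iff \mathrm{NP}\not\subseteq\mathrm{P/poly}.$$ -/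

import Mathlib

namespace NonuniformIS

/-! ### Single-pass instruction sequences acting on Boolean registers

All registers and propositional variables are numbered from `0`. -/

/-- Foci: names of the input registers, the auxiliary registers and the output register. -/
inductive Focus where
  | inp (i : ℕ)
  | aux (i : ℕ)
  | out
  deriving DecidableEq

/-- Methods that Boolean register services can process. -/
inductive Meth where
  | set (b : Bool)
  | get

/-- Basic instructions (also the basic actions of threads) `f.m`. -/
structure BasicInstr where
  focus : Focus
  meth : Meth

/-- Primitive instructions. -/
inductive PrimInstr where
  /-- plain basic instruction `a` -/
  | plain (a : BasicInstr)
  /-- positive test instruction `+a` -/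
  | posTest (a : BasicInstr)
  /-- negative test instruction `-a` -/
  | negTest (a : BasicInstr)
  /-- forward jump instruction `#l` -/
  | jump (l : ℕ)
  /-- termination instruction `!` -/
  | halt

/-- Finite threads: inaction `D`, termination `S`, internal action prefixing `tau ∘ p`, and
postconditional composition `p ⊴ a ⊵ q` (first `a`, then `p` on reply true, `q` on reply false).
Since `p ⊴ tau ⊵ q = p ⊴ tau ⊵ p`, the internal action needs only one continuation. -/
inductive Thread where
  | inaction
  | terminated
  | tau (p : Thread)
  | pcc (p : Thread) (a : BasicInstr) (q : Thread)

/-- Thread extraction: the behaviour produced by an instruction sequence. The empty list is only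
reached when there is no primitive instruction to proceed with, in which case inaction occurs. -/
def extract : List PrimInstr → Thread
  | [] => .inaction
  | .plain a :: X => .pcc (extract X) a (extract X)
  | .posTest a :: X => .pcc (extract X) a (extract (X.drop 1))
  | .negTest a :: X => .pcc (extract (X.drop 1)) a (extract X)
  | .jump 0 :: _ => .inaction
  | .jump (l + 1) :: X => extract (X.drop l)
  | .halt :: _ => .terminated
  termination_by X => X.length
  decreasing_by all_goals simp only [List.length_cons, List.length_drop]; omega

/-- Services: the empty service and the Boolean register with content `b`. -/
inductive Service where
  | empty
  | reg (b : Bool)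

/-- The derived service after processing a method. -/
def Service.derive : Meth → Service → Service
  | _, .empty => .empty
  | .set b, .reg _ => .reg b
  | .get, .reg b => .reg b

/-- The reply of a service to a method; `none` is the reply "blocked". -/
def Service.reply : Meth → Service → Option Bool
  | _, .empty => none
  | .set b, .reg _ => some b
  | .get, .reg b => some b

/-- The use operator: the thread that results when the service `S`, named `f`, processes the
actions `f.m` of the thread. -/
def Thread.use (f : Focus) : Thread → Service → Thread
  | .inaction, _ => .inaction
  | .terminated, _ => .terminated
  | .tau p, S => .tau (p.use f S)
  | .pcc p a q, S =>
    if a.focus = f then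
      match S.reply a.meth with
      | some true => .tau (p.use f (S.derive a.meth))
      | some false => .tau (q.use f (S.derive a.meth))
      | none => .tau .inaction
    else .pcc (p.use f S) a (q.use f S)

/-- The apply operator: the service that results when the service `S`, named `f`, processes the
actions `f.m` of the thread. -/
def Thread.apply (f : Focus) : Thread → Service → Service
  | .inaction, _ => .empty
  | .terminated, S => S
  | .tau p, S => p.apply f S
  | .pcc p a q, S =>
    if a.focus = f then
      match S.reply a.meth with
      | some true => p.apply f (S.derive a.meth)
      | some false => q.apply f (S.derive a.meth)
      | none => .empty
    else .empty

/-- Basic instructions allowed in the instruction sequences considered: input registers can be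
read, auxiliary registers can be read and written, the output register can be written. -/
def BasicInstr.IsAllowed : BasicInstr → Prop
  | ⟨.inp _, .get⟩ => True
  | ⟨.aux _, _⟩ => True
  | ⟨.out, .set _⟩ => True
  | _ => False

/-- Primitive instructions built from allowed basic instructions. -/
def PrimInstr.IsAllowed : PrimInstr → Prop
  | .plain a | .posTest a | .negTest a => a.IsAllowed
  | .jump _ | .halt => True

/-- The set of all (non-empty, finite) instruction sequences acting on Boolean registers. -/
def ISbr : Set (List PrimInstr) :=
  {X | X ≠ [] ∧ ∀ u ∈ X, u.IsAllowed}

/-- `X` computes the Boolean function `f`: for some number `l` of auxiliary registers, all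
initially false, running `X` with its input registers containing `b` and its output register
initially false leaves `f b` in the output register. -/
def Computes {n : ℕ} (X : List PrimInstr) (f : (Fin n → Bool) → Bool) : Prop :=
  ∃ l : ℕ, ∀ b : Fin n → Bool,
    let p₁ := (List.range l).foldl (fun p i => p.use (.aux i) (.reg false)) (extract X)
    let p₂ := (List.finRange n).foldl (fun p i => p.use (.inp i) (.reg (b i))) p₁
    p₂.apply .out (.reg false) = .reg (f b)

/-- Boolean function families. -/
abbrev BoolFunFamily : Type := ∀ n : ℕ, (Fin n → Bool) → Bool

/-- The class of families computed by instruction sequences from `IS` of length bounded by a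
function from `F`. -/
def nuc (IS : Set (List PrimInstr)) (F : Set (ℕ → ℕ)) : Set BoolFunFamily :=
  {f | ∃ h ∈ F, ∀ n, ∃ X ∈ IS, Computes X (f n) ∧ X.length ≤ h n}

/-- The polynomial functions from `ℕ` to `ℕ`. -/
def poly : Set (ℕ → ℕ) :=
  {h | ∃ p : Polynomial ℚ, ∀ n : ℕ, (h n : ℚ) = p.eval (n : ℚ)}

/-- Families computable by polynomial-length instruction sequences. -/
def PLIS : Set BoolFunFamily := nuc ISbr poly

/-! ### 3-CNF formulas, 3SAT and 3SATC -/

/-- The literal `(v, true)` is the variable `v`, the literal `(v, false)` is its negation. -/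
abbrev Literal : Type := ℕ × Bool

/-- Truth of a literal under an assignment. -/
def Literal.Holds (σ : ℕ → Bool) (l : Literal) : Prop := σ l.1 = l.2

/-- CNF formulas: conjunctions of disjunctions of literals. -/
abbrev CNF : Type := List (List Literal)

/-- Satisfiability of a CNF formula. -/
def CNF.Satisfiable (φ : CNF) : Prop :=
  ∃ σ : ℕ → Bool, ∀ c ∈ φ, ∃ l ∈ c, Literal.Holds σ l

/-- Formulas in which every clause has at most three literals. -/
def CNF.Is3CNF (φ : CNF) : Prop := ∀ c ∈ φ, c.length ≤ 3

/-- Code of a literal: its sign, then the binary digits of the variable's number, least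
significant first, each preceded by `true`, then `false`. -/
def encodeLiteral (l : Literal) : List Bool :=
  l.2 :: (l.1.bits.flatMap (fun b => [true, b]) ++ [false])

/-- Code of a clause: the codes of its literals, each preceded by `true`, then `false`. -/
def encodeClause (c : List Literal) : List Bool :=
  c.flatMap (fun l => true :: encodeLiteral l) ++ [false]

/-- Code of a CNF formula: the codes of its clauses, concatenated (each is self-delimiting). -/
def encodeCNF (φ : CNF) : List Bool := φ.flatMap encodeClause

/-- The language of (codes of) satisfiable 3-CNF formulas. -/
def threeSAT : Language Bool :=
  {w | ∃ φ : CNF, φ.Is3CNF ∧ φ.Satisfiable ∧ encodeCNF φ = w}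

/-- The number of sets of one, two or three literals over `k` variables. -/
def numDisj (k : ℕ) : ℕ := (2 * k).choose 1 + (2 * k).choose 2 + (2 * k).choose 3

/-- The sets of one, two or three literals over the first `k` variables. -/
def disjSets (k : ℕ) : Set (Finset Literal) :=
  {L | (∀ l ∈ L, l.1 < k) ∧ 1 ≤ L.card ∧ L.card ≤ 3}

/-- A coherent family of numberings: `disj k` numbers the disjunctions over the first `k`
variables bijectively by `0, ..., numDisj k - 1` (its values elsewhere are irrelevant), and
`disj (k + 1)` extends `disj k`. -/
structure DisjNumbering where
  disj : ℕ → ℕ → Finset Literal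
  bijOn : ∀ k, Set.BijOn (disj k) (Set.Iio (numDisj k)) (disjSets k)
  coherent : ∀ k, ∀ j < numDisj k, disj (k + 1) j = disj k j

/-- The greatest `k` with `numDisj k ≤ n`. As `numDisj` is strictly increasing from `0`, this is
the unique `k` with `numDisj k ≤ n < numDisj (k + 1)`. -/
def numVars (n : ℕ) : ℕ := Nat.findGreatest (fun k => numDisj k ≤ n) n

open Classical in
/-- The family 3SATC: with `k = numVars n`, the first `numDisj k` bits of `b` say which
disjunctions over the first `k` variables occur in the formula, the other bits are ignored, and
the value says whether that formula is satisfiable. -/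
noncomputable def threeSATC (α : DisjNumbering) : BoolFunFamily := fun n b =>
  decide (∃ σ : ℕ → Bool, ∀ i : Fin n, (i : ℕ) < numDisj (numVars n) → b i = true →
    ∃ l ∈ α.disj (numVars n) i, Literal.Holds σ l)

/-! ### Boolean circuits and P/poly -/

/-- The gates whose predecessors are among `m` earlier nodes. -/
inductive Gate (m : ℕ) where
  | const (b : Bool)
  | not (i : Fin m)
  | and (i j : Fin m)
  | or (i j : Fin m)

/-- The output of a gate, given the values of the earlier nodes. -/
def Gate.eval {m : ℕ} (v : Fin m → Bool) : Gate m → Bool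
  | .const b => b
  | .not i => !(v i)
  | .and i j => v i && v j
  | .or i j => v i || v j

/-- Boolean circuits (directed acyclic graphs, listed in topological order) with `n` input nodes
and `s` nodes altogether. -/
inductive Circuit (n : ℕ) : ℕ → Type where
  | inputs : Circuit n n
  | snoc {s : ℕ} (C : Circuit n s) (g : Gate s) : Circuit n (s + 1)

/-- The values of all nodes of a circuit on input `x`. -/
def Circuit.eval {n : ℕ} (x : Fin n → Bool) : {s : ℕ} → Circuit n s → Fin s → Bool
  | _, .inputs => x
  | _, .snoc C g => Fin.snoc (α := fun _ => Bool) (C.eval x) (g.eval (C.eval x))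

/-- P/poly: the languages decided by families of polynomial-size Boolean circuits with one
output node, the size being the number of nodes. -/
def PPoly : Set (Language Bool) :=
  {L | ∃ h ∈ poly, ∀ n, ∃ s ≤ h n, ∃ (C : Circuit n s) (o : Fin s),
    ∀ x : Fin n → Bool, C.eval x o = true ↔ List.ofFn x ∈ L}

/-! ### NP -/

/-- The Boolean function `V` of two binary words is computable in polynomial time. -/
def PolyTimeVerifier (V : List Bool → List Bool → Bool) : Prop :=
  Nonempty (Turing.TM2ComputableInPolyTime
    (Computability.encodingProd (Computability.encodingList Bool)
      (Computability.encodingList Bool)).encode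
    Computability.encodeBool (fun xu : List Bool × List Bool => V xu.1 xu.2))

/-- NP: the languages with polynomial-length certificates that are verifiable in polynomial
time. -/
def NP : Set (Language Bool) :=
  {L | ∃ h ∈ poly, ∃ V : List Bool → List Bool → Bool, PolyTimeVerifier V ∧
    ∀ x : List Bool, x ∈ L ↔ ∃ u : List Bool, u.length = h x.length ∧ V x u = true}

end NonuniformIS

/-! Both equivalences follow from a cycle of implications: 3SATC ∈ PLIS gives NP ⊆ P/poly, which
gives 3SAT ∈ P/poly, which gives 3SATC ∈ PLIS.

Instruction sequences and circuits simulate each other with polynomial overhead. Jumps only go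
forward, so each position is executed at most once and a single sweep over the positions can be laid
out as a circuit (`Computes.hasCircuit`). Conversely each gate becomes at most four instructions
writing one auxiliary register (`HasCircuit.exists_computes`).

From 3SATC to NP (`NP_subset_PPoly`): on inputs of fixed length a polynomial-time verifier unrolls
into a polynomial-size circuit (`hasCircuit_cfg`). The existence of a certificate for `x` then
amounts to satisfiability of the clauses describing this circuit, its output being true and its
first inputs being `x`. This is a 3SATC instance each of whose bits depends on at most one bit of
`x`, so circuits for 3SATC decide the language (`mem_PPoly_of_nondeterministic`).

From NP to 3SAT: an explicit stack machine checks certificates for 3SAT (`threeSAT_mem_NP`). The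
certificate annotates each literal occurrence with the value of its variable; a finite automaton
checks syntax and truth of the clauses, and pairwise comparison checks that equal variables got
equal values.

From 3SAT to 3SATC (`threeSATC_mem_PLIS`): absent clauses are replaced by harmless clauses of the
same code length, so the code of the formula has a length depending only on `n`, and each of its
bits depends on one input bit.

Both unrollings rest on `HasCircuit.tableau`: if every bit of a row depends on boundedly many bits
of the preceding row, the table is a circuit of size proportional to its area. -/

namespace NonuniformIS

/-! ### Polynomially bounded functions -/

/-- Functions bounded by a polynomial with natural coefficients. -/
def PolyBound (f : ℕ → ℕ) : Prop := ∃ p : Polynomial ℕ, ∀ n, f n ≤ p.eval n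

/-- Monotonicity is the reason for bounding by polynomials over ℕ: it lets bounds be composed and
weakened in their argument. -/
theorem eval_mono_nat (p : Polynomial ℕ) {a b : ℕ} (h : a ≤ b) : p.eval a ≤ p.eval b := by
  induction p using Polynomial.induction_on' with
  | add p q hp hq => simpa using add_le_add hp hq
  | monomial n c => simp only [Polynomial.eval_monomial]; gcongr

namespace PolyBound

theorem mono {f g : ℕ → ℕ} (hg : PolyBound g) (h : ∀ n, f n ≤ g n) : PolyBound f :=
  hg.imp fun _ hp n => (h n).trans (hp n)

theorem const (c : ℕ) : PolyBound fun _ => c := ⟨Polynomial.C c, fun n => by simp⟩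

theorem id : PolyBound fun n => n := ⟨Polynomial.X, fun n => by simp⟩

theorem eval (p : Polynomial ℕ) : PolyBound fun n => p.eval n := ⟨p, fun _ => le_rfl⟩

theorem add {f g : ℕ → ℕ} (hf : PolyBound f) (hg : PolyBound g) : PolyBound fun n => f n + g n := by
  obtain ⟨p, hp⟩ := hf
  obtain ⟨q, hq⟩ := hg
  exact ⟨p + q, fun n => by simpa using add_le_add (hp n) (hq n)⟩

theorem mul {f g : ℕ → ℕ} (hf : PolyBound f) (hg : PolyBound g) : PolyBound fun n => f n * g n := by
  obtain ⟨p, hp⟩ := hf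
  obtain ⟨q, hq⟩ := hg
  exact ⟨p * q, fun n => by simpa using Nat.mul_le_mul (hp n) (hq n)⟩

theorem pow {f : ℕ → ℕ} (hf : PolyBound f) (k : ℕ) : PolyBound fun n => f n ^ k := by
  obtain ⟨p, hp⟩ := hf
  exact ⟨p ^ k, fun n => by simpa using Nat.pow_le_pow_left (hp n) k⟩

theorem comp {f g : ℕ → ℕ} (hf : PolyBound f) (hg : PolyBound g) : PolyBound fun n => f (g n) := by
  obtain ⟨p, hp⟩ := hf
  obtain ⟨q, hq⟩ := hg
  refine ⟨p.comp q, fun n => (hp _).trans ?_⟩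
  simpa [Polynomial.eval_comp] using eval_mono_nat p (hq n)

/-- A polynomially bounded function has a monotone polynomial bound. -/
theorem exists_monotone {f : ℕ → ℕ} (hf : PolyBound f) :
    ∃ g : ℕ → ℕ, Monotone g ∧ PolyBound g ∧ ∀ n, f n ≤ g n := by
  obtain ⟨p, hp⟩ := hf
  exact ⟨fun n => p.eval n, fun a b h => eval_mono_nat p h, eval p, hp⟩

theorem exists_mem_poly {f : ℕ → ℕ} (hf : PolyBound f) : ∃ h ∈ poly, ∀ n, f n ≤ h n := by
  obtain ⟨p, hp⟩ := hf
  refine ⟨fun n => p.eval n, ⟨p.map (Nat.castRingHom ℚ), fun n => ?_⟩, hp⟩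
  rw [← map_natCast (Nat.castRingHom ℚ) n, Polynomial.eval_map, Polynomial.eval₂_at_apply]
  simp

/-- Members of `poly` may have negative or fractional coefficients; rounding the absolute value of
each coefficient up gives a majorant over ℕ. -/
theorem of_mem_poly {h : ℕ → ℕ} (hh : h ∈ poly) : PolyBound h := by
  obtain ⟨p, hp⟩ := hh
  suffices H : ∀ q : Polynomial ℚ, ∃ r : Polynomial ℕ, ∀ n : ℕ, q.eval (n : ℚ) ≤ (r.eval n : ℕ) by
    obtain ⟨r, hr⟩ := H p
    exact ⟨r, fun n => by exact_mod_cast (hp n).le.trans (hr n)⟩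
  intro q
  induction q using Polynomial.induction_on' with
  | add p q hp hq =>
    obtain ⟨r, hr⟩ := hp
    obtain ⟨s, hs⟩ := hq
    exact ⟨r + s, fun n => by simpa using add_le_add (hr n) (hs n)⟩
  | monomial m c =>
    refine ⟨Polynomial.monomial m ⌈|c|⌉₊, fun n => ?_⟩
    simp only [Polynomial.eval_monomial]
    push_cast
    gcongr
    exact (le_abs_self c).trans (Nat.le_ceil _)

end PolyBound

/-! ### Families of functions realized by circuits -/

/-- Some node of the circuit computes `f`. -/
def Circuit.Realizes {n s : ℕ} (C : Circuit n s) (f : (Fin n → Bool) → Bool) : Prop :=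
  ∃ o, ∀ x, C.eval x o = f x

theorem Circuit.Realizes.snoc {n s : ℕ} {C : Circuit n s} {f : (Fin n → Bool) → Bool}
    (h : C.Realizes f) (g : Gate s) : (C.snoc g).Realizes f := by
  obtain ⟨o, ho⟩ := h
  exact ⟨o.castSucc, fun x => by simp [Circuit.eval, ho]⟩

theorem Circuit.realizes_last {n s : ℕ} (C : Circuit n s) (g : Gate s) :
    (C.snoc g).Realizes fun x => g.eval (C.eval x) :=
  ⟨Fin.last s, fun x => by simp [Circuit.eval]⟩

/-- Some circuit with at most `s` nodes computes all the functions in `F`. -/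
def HasCircuit (n s : ℕ) (F : Set ((Fin n → Bool) → Bool)) : Prop :=
  ∃ s' ≤ s, ∃ C : Circuit n s', ∀ f ∈ F, C.Realizes f

namespace HasCircuit

variable {n s : ℕ} {F : Set ((Fin n → Bool) → Bool)}

theorem mono (h : HasCircuit n s F) {t : ℕ} (hst : s ≤ t) {G : Set ((Fin n → Bool) → Bool)}
    (hG : G ⊆ F) : HasCircuit n t G := by
  obtain ⟨s', hs', C, hC⟩ := h
  exact ⟨s', hs'.trans hst, C, fun f hf => hC f (hG hf)⟩

theorem inputs (n : ℕ) : HasCircuit n n (Set.range fun (i : Fin n) x => x i) := by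
  refine ⟨n, le_rfl, .inputs, ?_⟩
  rintro _ ⟨i, rfl⟩
  exact ⟨i, fun x => rfl⟩

theorem const (h : HasCircuit n s F) (b : Bool) : HasCircuit n (s + 1) (insert (fun _ => b) F) := by
  obtain ⟨s', hs', C, hC⟩ := h
  refine ⟨s' + 1, by omega, C.snoc (.const b), ?_⟩
  rintro f (rfl | hf)
  · exact C.realizes_last (.const b)
  · exact (hC f hf).snoc _

theorem not (h : HasCircuit n s F) {f : (Fin n → Bool) → Bool} (hf : f ∈ F) :
    HasCircuit n (s + 1) (insert (fun x => !(f x)) F) := by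
  obtain ⟨s', hs', C, hC⟩ := h
  obtain ⟨i, hi⟩ := hC f hf
  refine ⟨s' + 1, by omega, C.snoc (.not i), ?_⟩
  rintro g (rfl | hg)
  · simpa [Gate.eval, hi] using C.realizes_last (.not i)
  · exact (hC g hg).snoc _

theorem and (h : HasCircuit n s F) {f g : (Fin n → Bool) → Bool} (hf : f ∈ F) (hg : g ∈ F) :
    HasCircuit n (s + 1) (insert (fun x => f x && g x) F) := by
  obtain ⟨s', hs', C, hC⟩ := h
  obtain ⟨i, hi⟩ := hC f hf
  obtain ⟨j, hj⟩ := hC g hg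
  refine ⟨s' + 1, by omega, C.snoc (.and i j), ?_⟩
  rintro k (rfl | hk)
  · simpa [Gate.eval, hi, hj] using C.realizes_last (.and i j)
  · exact (hC k hk).snoc _

theorem or (h : HasCircuit n s F) {f g : (Fin n → Bool) → Bool} (hf : f ∈ F) (hg : g ∈ F) :
    HasCircuit n (s + 1) (insert (fun x => f x || g x) F) := by
  obtain ⟨s', hs', C, hC⟩ := h
  obtain ⟨i, hi⟩ := hC f hf
  obtain ⟨j, hj⟩ := hC g hg
  refine ⟨s' + 1, by omega, C.snoc (.or i j), ?_⟩
  rintro k (rfl | hk)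
  · simpa [Gate.eval, hi, hj] using C.realizes_last (.or i j)
  · exact (hC k hk).snoc _

/-- A number of gates sufficient to compute any function of `m` nodes. -/
def localCost : ℕ → ℕ
  | 0 => 1
  | m + 1 => 2 * localCost m + 4

theorem localCost_mono : Monotone localCost :=
  monotone_nat_of_le_succ fun n => by simp only [localCost]; omega

/-- Shannon expansion on the first node: `g` equals `f ∧ g(true, …) ∨ ¬f ∧ g(false, …)`. Two
circuits for the shorter list and four gates give the recursion of `localCost`. -/
theorem list_fun (fs : List ((Fin n → Bool) → Bool)) (g : List Bool → Bool) {s : ℕ}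
    {F : Set ((Fin n → Bool) → Bool)} (h : HasCircuit n s F) (hfs : ∀ f ∈ fs, f ∈ F) :
    HasCircuit n (s + localCost fs.length) (insert (fun x => g (fs.map fun f => f x)) F) := by
  induction fs generalizing g s F with
  | nil => simpa [localCost] using h.const (g [])
  | cons f fs ih =>
    have h1 := ih (fun l => g (true :: l)) h fun f hf => hfs f (by simp [hf])
    have h0 := ih (fun l => g (false :: l)) h1 fun f hf => .inr (hfs f (by simp [hf]))
    have hf : f ∈ F := hfs f (by simp)
    have h2 := h0.not (f := f) (by simp [hf])
    have h3 := h2.and (f := f) (g := fun x => g (true :: fs.map fun f => f x)) (by simp [hf])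
      (by simp)
    have h4 := h3.and (f := fun x => !(f x)) (g := fun x => g (false :: fs.map fun f => f x))
      (by simp) (by simp)
    have h5 := h4.or (f := fun x => f x && g (true :: fs.map fun f => f x))
      (g := fun x => !(f x) && g (false :: fs.map fun f => f x)) (by simp) (by simp)
    refine h5.mono (by simp only [List.length_cons, localCost]; omega) ?_
    rintro k (rfl | hk)
    · left
      funext x
      cases hx : f x <;> simp [hx]
    · simp [hk]

/-- A function determined by at most `m` nodes can be added at constant cost. -/
theorem insert_of_determined {ι : Type*} (h : HasCircuit n s F) {m : ℕ} (J : Finset ι)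
    (hJ : J.card ≤ m) (f : ι → (Fin n → Bool) → Bool) (hf : ∀ j ∈ J, f j ∈ F)
    (G : (Fin n → Bool) → Bool) (hG : ∀ x y, (∀ j ∈ J, f j x = f j y) → G x = G y) :
    HasCircuit n (s + localCost m) (insert G F) := by
  -- `G` is a function of the list of values of the nodes in `J`; `Function.extend` turns it into a
  -- function of all Boolean lists, with value `false` on lists that do not arise.
  have hfac : Function.FactorsThrough G (fun x => (J.toList.map f).map fun f => f x) := by
    intro x y hxy
    refine hG x y fun j hj => ?_
    simp only [List.map_map, List.map_inj_left, Function.comp_apply] at hxy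
    exact hxy j (by simpa using hj)
  have hext := hfac.extend_apply (fun _ => false)
  have := list_fun (J.toList.map f) (Function.extend (fun x => (J.toList.map f).map fun f => f x) G
    fun _ => false) h (by simpa using hf)
  refine this.mono ?_ ?_
  · simpa using localCost_mono hJ
  · rintro k (rfl | hk)
    · exact .inl (funext fun x => (hext x).symm)
    · exact .inr hk

/-- All new functions are computed from the old nodes `f j` and not from each other, so the costs
merely add up. This yields one row of a tableau. -/
theorem union_of_determined {ι κ : Type*} (h : HasCircuit n s F) {m : ℕ}
    (f : ι → (Fin n → Bool) → Bool) (hf : ∀ j, f j ∈ F) (P : Finset κ)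
    (G : κ → (Fin n → Bool) → Bool)
    (hG : ∀ p ∈ P, ∃ J : Finset ι, J.card ≤ m ∧
      ∀ x y, (∀ j ∈ J, f j x = f j y) → G p x = G p y) :
    HasCircuit n (s + P.card * localCost m) (F ∪ G '' P) := by
  classical
  induction P using Finset.induction_on with
  | empty => simpa using h
  | insert p P hp ih =>
    obtain ⟨J, hJ, hJG⟩ := hG p (by simp)
    have := (ih fun q hq => hG q (by simp [hq])).insert_of_determined J hJ f
      (fun j _ => .inl (hf j)) (G p) hJG
    refine this.mono ?_ ?_
    · rw [Finset.card_insert_of_notMem hp]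
      linarith
    · rw [Finset.coe_insert, Set.image_insert_eq]
      intro k hk
      simp only [Set.mem_union, Set.mem_insert_iff] at hk ⊢
      tauto

/-- If each bit of a tableau is determined by at most `m` bits of the previous row, all bits of a
row are computed by small circuits. -/
theorem tableau {ι : Type*} [Fintype ι] (T : ℕ → (Fin n → Bool) → ι → Bool) (m : ℕ)
    (h0 : ∀ p, ∃ J : Finset (Fin n), J.card ≤ m ∧
      ∀ x y : Fin n → Bool, (∀ j ∈ J, x j = y j) → T 0 x p = T 0 y p)
    (hstep : ∀ t p, ∃ J : Finset ι, J.card ≤ m ∧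
      ∀ x y : Fin n → Bool, (∀ j ∈ J, T t x j = T t y j) → T (t + 1) x p = T (t + 1) y p)
    (t : ℕ) :
    HasCircuit n (n + (t + 1) * (Fintype.card ι * localCost m))
      (Set.range fun p x => T t x p) := by
  induction t with
  | zero =>
    have := (inputs n).union_of_determined (fun j x => x j) (fun j => ⟨j, rfl⟩) Finset.univ
      (fun p x => T 0 x p) fun p _ => h0 p
    refine this.mono (by simp) ?_
    rintro _ ⟨p, rfl⟩
    exact .inr ⟨p, by simp⟩
  | succ t ih =>
    have := ih.union_of_determined (fun j x => T t x j) (fun j => ⟨j, rfl⟩) Finset.univ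
      (fun p x => T (t + 1) x p) fun p _ => hstep t p
    refine this.mono (by rw [Finset.card_univ]; linarith) ?_
    rintro _ ⟨p, rfl⟩
    exact .inr ⟨p, by simp⟩

/-- Substitution of functions for the inputs of a circuit. -/
theorem subst {N S : ℕ} (C : Circuit N S) (π : (Fin n → Bool) → Fin N → Bool)
    (h : HasCircuit n s F) (hπ : ∀ i, (fun x => π x i) ∈ F) :
    HasCircuit n (s + S) (F ∪ Set.range fun (o : Fin S) x => C.eval (π x) o) := by
  induction C with
  | inputs =>
    refine h.mono (by omega) ?_
    rintro _ (hk | ⟨o, rfl⟩)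
    · exact hk
    · exact hπ o
  | @snoc S C g ih =>
    suffices H : HasCircuit n (s + S + 1) (insert (fun x => g.eval (C.eval (π x)))
        (F ∪ Set.range fun (o : Fin S) x => C.eval (π x) o)) by
      refine H.mono (by omega) ?_
      rintro _ (hk | ⟨o, rfl⟩)
      · exact .inr (.inl hk)
      · refine Fin.lastCases ?_ (fun o => ?_) o
        · exact .inl (by simp [Circuit.eval])
        · exact .inr (.inr ⟨o, by simp [Circuit.eval]⟩)
    cases g with
    | const b => exact ih.const b
    | not i => exact ih.not (f := fun x => C.eval (π x) i) (.inr ⟨i, rfl⟩)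
    | and i j =>
      exact ih.and (f := fun x => C.eval (π x) i) (g := fun x => C.eval (π x) j)
        (.inr ⟨i, rfl⟩) (.inr ⟨j, rfl⟩)
    | or i j =>
      exact ih.or (f := fun x => C.eval (π x) i) (g := fun x => C.eval (π x) j)
        (.inr ⟨i, rfl⟩) (.inr ⟨j, rfl⟩)

/-- Substitution of functions of at most one input for the inputs of a circuit. -/
theorem subst_projection {N S : ℕ} {f : (Fin N → Bool) → Bool} (h : HasCircuit N S {f})
    (π : (Fin n → Bool) → Fin N → Bool)
    (hπ : ∀ i, ∃ J : Finset (Fin n), J.card ≤ 1 ∧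
      ∀ x y, (∀ j ∈ J, x j = y j) → π x i = π y i) :
    HasCircuit n (n + N * localCost 1 + S) {fun x => f (π x)} := by
  obtain ⟨S', hS', C, hC⟩ := h
  obtain ⟨o, ho⟩ := hC f rfl
  have h1 := (inputs n).union_of_determined (fun j x => x j) (fun j => ⟨j, rfl⟩) Finset.univ
      (fun i x => π x i) fun i _ => hπ i
  have h2 := h1.subst C π fun i => .inr ⟨i, by simp⟩
  refine h2.mono (by simpa using hS') ?_
  rintro _ rfl
  exact .inr ⟨o, by simp [ho]⟩

end HasCircuit

/-- Membership in P/poly in terms of `HasCircuit`, with a polynomial upper bound in place of a size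
function that is itself polynomial. -/
theorem mem_PPoly_iff {L : Language Bool} :
    L ∈ PPoly ↔ ∃ h : ℕ → ℕ, PolyBound h ∧ ∀ n, ∃ f : (Fin n → Bool) → Bool,
      HasCircuit n (h n) {f} ∧ ∀ x, f x = true ↔ List.ofFn x ∈ L := by
  constructor
  · rintro ⟨h, hh, H⟩
    refine ⟨h, .of_mem_poly hh, fun n => ?_⟩
    obtain ⟨s, hs, C, o, hC⟩ := H n
    exact ⟨fun x => C.eval x o, ⟨s, hs, C, by rintro _ rfl; exact ⟨o, fun x => rfl⟩⟩, hC⟩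
  · rintro ⟨h, hh, H⟩
    obtain ⟨h', hh', hle⟩ := hh.exists_mem_poly
    refine ⟨h', hh', fun n => ?_⟩
    obtain ⟨f, ⟨s, hs, C, hC⟩, hf⟩ := H n
    obtain ⟨o, ho⟩ := hC f rfl
    exact ⟨s, hs.trans (hle n), C, o, fun x => by rw [ho, hf]⟩

end NonuniformIS

namespace NonuniformIS

/-! ### Instruction sequences and circuits -/

/-- The final content of the output register when the thread acts on registers with contents `ρ`;
`none` if the thread does not terminate properly. -/
def Thread.run : Thread → (Focus → Option Bool) → Option Bool
  | .inaction, _ => none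
  | .terminated, ρ => ρ .out
  | .tau p, ρ => p.run ρ
  | .pcc p a q, ρ =>
    match ρ a.focus, a.meth with
    | none, _ => none
    | some true, .get => p.run ρ
    | some false, .get => q.run ρ
    | some _, .set true => p.run (Function.update ρ a.focus (some true))
    | some _, .set false => q.run (Function.update ρ a.focus (some false))

/-- An action touches one register only, so letting a service process its actions beforehand is the
same as starting with that register filled. The output register is excluded because `run` reads it
on termination, when `use` would already have discarded the service. -/
theorem Thread.run_use {f : Focus} (hf : f ≠ .out) (p : Thread) (b : Bool)
    (ρ : Focus → Option Bool) :
    (p.use f (.reg b)).run ρ = p.run (Function.update ρ f (some b)) := by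
  induction p generalizing b ρ with
  | inaction => rfl
  | terminated => simp [Thread.use, Thread.run, hf.symm]
  | tau p ih => simpa [Thread.use, Thread.run] using ih b ρ
  | pcc p a q ihp ihq =>
    obtain ⟨g, m⟩ := a
    by_cases hg : g = f
    · subst hg
      rcases m with (_ | _) | _ <;> cases b <;>
        simp [Thread.use, Thread.run, Service.reply, Service.derive, ihp, ihq]
    · cases hρ : ρ g with
      | none => simp [Thread.use, Thread.run, hg, hρ]
      | some v =>
        rcases m with (_ | _) | _ <;> cases v <;>
          simp [Thread.use, Thread.run, hg, hρ, ihp, ihq, Function.update_comm hg]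

/-- The service resulting from a run. -/
def Service.ofOption : Option Bool → Service
  | none => .empty
  | some b => .reg b

theorem Service.ofOption_eq_reg {o : Option Bool} {b : Bool} :
    Service.ofOption o = .reg b ↔ o = some b := by
  cases o <;> simp [Service.ofOption]

/-- Actions on other foci make `apply` yield the empty service; this is matched by leaving all other
registers undefined. -/
theorem Thread.apply_out (p : Thread) (b : Bool) :
    p.apply .out (.reg b) =
      Service.ofOption (p.run (Function.update (fun _ => none) .out (some b))) := by
  induction p generalizing b with
  | inaction => rfl
  | terminated => simp [Thread.apply, Thread.run, Service.ofOption]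
  | tau p ih => simpa [Thread.apply, Thread.run] using ih b
  | pcc p a q ihp ihq =>
    obtain ⟨g, m⟩ := a
    by_cases hg : g = .out
    · subst hg
      rcases m with (_ | _) | _ <;> cases b <;>
        simp [Thread.apply, Thread.run, Service.reply, Service.derive, ihp, ihq]
    · simp [Thread.apply, Thread.run, hg, Service.ofOption]

theorem Thread.run_foldl_use {ι : Type*} (L : List ι) (f : ι → Focus) (hf : ∀ i, f i ≠ .out)
    (b : ι → Bool) (p : Thread) (ρ : Focus → Option Bool) :
    (L.foldl (fun p i => p.use (f i) (.reg (b i))) p).run ρ =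
      p.run (L.foldr (fun i ρ => Function.update ρ (f i) (some (b i))) ρ) := by
  induction L generalizing p with
  | nil => rfl
  | cons i L ih => simp [ih, Thread.run_use (hf i)]

theorem foldr_update_apply {ι : Type*} (L : List ι) (f : ι → Focus) (hf : Function.Injective f)
    (b : ι → Bool) (ρ : Focus → Option Bool) :
    (∀ i ∈ L, L.foldr (fun i ρ => Function.update ρ (f i) (some (b i))) ρ (f i) = some (b i)) ∧
    ∀ g, (∀ i ∈ L, g ≠ f i) →
      L.foldr (fun i ρ => Function.update ρ (f i) (some (b i))) ρ g = ρ g := by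
  induction L with
  | nil => simp
  | cons i L ih =>
    constructor
    · intro j hj
      by_cases hij : j = i
      · simp [hij]
      · have : f j ≠ f i := fun h => hij (hf h)
        have hj' : j ∈ L := by simpa [hij] using hj
        simpa [Function.update_of_ne this] using ih.1 j hj'
    · intro g hg
      have : g ≠ f i := hg i (by simp)
      simpa [Function.update_of_ne this] using ih.2 g fun i hi => hg i (by simp [hi])

/-- The initial contents of the registers. -/
def initRegs (l : ℕ) {n : ℕ} (b : Fin n → Bool) : Focus → Option Bool
  | .inp i => if h : i < n then some (b ⟨i, h⟩) else none
  | .aux i => if i < l then some false else none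
  | .out => some false

/-- Replaces thread algebra by an operational semantics on register contents; all later arguments
use this form. -/
theorem computes_iff {n : ℕ} (X : List PrimInstr) (f : (Fin n → Bool) → Bool) :
    Computes X f ↔ ∃ l : ℕ, ∀ b, (extract X).run (initRegs l b) = some (f b) := by
  unfold Computes
  refine exists_congr fun l => forall_congr' fun b => ?_
  simp only
  rw [Thread.apply_out, Service.ofOption_eq_reg,
    Thread.run_foldl_use _ (fun i : Fin n => Focus.inp i) (by simp),
    Thread.run_foldl_use _ (fun i : ℕ => Focus.aux i) (by simp) (fun _ => false)]
  have h1 := foldr_update_apply (List.range l) (fun i : ℕ => Focus.aux i)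
    (fun i j h => by simpa using h) (fun _ => false)
  have h2 := foldr_update_apply (List.finRange n) (fun i : Fin n => Focus.inp i)
    (fun i j h => by simpa [Fin.ext_iff] using h) b
    (Function.update (fun _ => none) .out (some false))
  have : ∀ {ρ ρ' : Focus → Option Bool}, ρ = ρ' →
      ((extract X).run ρ = some (f b) ↔ (extract X).run ρ' = some (f b)) := by
    rintro _ _ rfl
    rfl
  apply this
  funext g
  cases g with
  | inp i =>
    rw [(h1 _).2 _ (by simp)]
    by_cases hi : i < n
    · simpa [initRegs, hi] using h2.1 ⟨i, hi⟩ (by simp)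
    · rw [h2.2 _ (by rintro ⟨j, hj⟩ -; simp; omega)]
      simp [initRegs, hi]
  | aux i =>
    by_cases hi : i < l
    · rw [(h1 _).1 i (by simpa using hi)]
      simp [initRegs, hi]
    · rw [(h1 _).2 _ (by intro j hj; simp at hj ⊢; omega), h2.2 _ (by simp)]
      simp [initRegs, hi]
  | out =>
    rw [(h1 _).2 _ (by simp), h2.2 _ (by simp)]
    simp [initRegs]

/-! #### From instruction sequences to circuits -/

/-- The basic instruction of a primitive instruction, if any. -/
def PrimInstr.basic : PrimInstr → Option BasicInstr
  | .plain a | .posTest a | .negTest a => some a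
  | .jump _ | .halt => none

/-- The focus of a primitive instruction, by default the output register. -/
def PrimInstr.focus (u : PrimInstr) : Focus := (u.basic.map BasicInstr.focus).getD .out

/-- The reply to the basic instruction of a primitive instruction. -/
def PrimInstr.replyOn (u : PrimInstr) (ρ : Focus → Option Bool) : Bool :=
  match u.basic with
  | some ⟨_, .set b⟩ => b
  | some ⟨f, .get⟩ => (ρ f).getD false
  | none => false

/-- The effect on the registers of a primitive instruction. -/
def PrimInstr.effect (u : PrimInstr) (ρ : Focus → Option Bool) : Focus → Option Bool :=
  match u.basic with
  | some ⟨f, .set b⟩ => Function.update ρ f (some b)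
  | _ => ρ

/-- The position after executing a primitive instruction at position `t`; `e` is used when
execution ends. -/
def PrimInstr.nextPos (e t : ℕ) (r : Bool) : PrimInstr → ℕ
  | .plain _ => t + 1
  | .posTest _ => bif r then t + 1 else t + 2
  | .negTest _ => bif r then t + 2 else t + 1
  | .jump 0 => e
  | .jump (l + 1) => t + 1 + l
  | .halt => e

/-- Pending position and register contents after positions below `t` have been handled. -/
def execAt (X : List PrimInstr) (ρ : Focus → Option Bool) : ℕ → ℕ × (Focus → Option Bool)
  | 0 => (0, ρ)
  | t + 1 =>
    let c := execAt X ρ t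
    if c.1 = t then
      match X[t]? with
      | none => c
      | some u => (u.nextPos X.length t (u.replyOn c.2), u.effect c.2)
    else c

/-- One sweep over the positions suffices because control never moves backwards. Either execution is
still to continue at the pending position and will yield `v`, or it has ended with `v` in the output
register. `#0` and running off the end also give pending positions beyond the sequence, but they
contradict `h`. -/
theorem execAt_invariant {X : List PrimInstr} {ρ : Focus → Option Bool} {v : Bool}
    (h : (extract X).run ρ = some v) (t : ℕ) :
    (t ≤ (execAt X ρ t).1 ∧
      (extract (X.drop (execAt X ρ t).1)).run (execAt X ρ t).2 = some v) ∨
    (X.length ≤ (execAt X ρ t).1 ∧ (execAt X ρ t).2 .out = some v) := by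
  induction t with
  | zero => simpa [execAt] using Or.inl h
  | succ t ih =>
    simp only [execAt]
    generalize execAt X ρ t = c at ih ⊢
    obtain ⟨pc, ρ⟩ := c
    simp only at ih ⊢
    split_ifs with hpc
    · subst hpc
      rcases ih with ⟨-, ih⟩ | ih
      · rcases lt_or_ge pc X.length with hlt | hge
        · rw [List.getElem?_eq_getElem hlt]
          rw [List.drop_eq_getElem_cons hlt] at ih
          simp only
          generalize X[pc] = u at ih ⊢
          rcases u with a | a | a | (_ | l) | _
          case jump.zero => simp [extract, Thread.run] at ih
          case jump.succ =>
            left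
            simp only [PrimInstr.nextPos, PrimInstr.effect, PrimInstr.basic]
            exact ⟨by omega, by simpa [extract] using ih⟩
          case halt =>
            right
            simpa [extract, Thread.run, PrimInstr.nextPos, PrimInstr.effect, PrimInstr.basic]
              using ih
          all_goals
            left
            obtain ⟨g, m⟩ := a
            cases hρ : ρ g with
            | none => simp [extract, Thread.run, hρ] at ih
            | some w =>
              rcases m with (_ | _) | _ <;> cases w <;>
                simpa [extract, Thread.run, PrimInstr.nextPos, PrimInstr.effect, PrimInstr.basic,
                  PrimInstr.replyOn, hρ] using ih
        · simp [List.drop_eq_nil_of_le hge, extract, Thread.run] at ih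
      · rw [List.getElem?_eq_none ih.1]
        exact .inr ih
    · rcases ih with ⟨hle, ih⟩ | ih
      · exact .inl ⟨by simp only; omega, ih⟩
      · exact .inr ih

theorem execAt_length {X : List PrimInstr} {ρ : Focus → Option Bool} {v : Bool}
    (h : (extract X).run ρ = some v) : (execAt X ρ X.length).2 .out = some v := by
  rcases execAt_invariant h X.length with ⟨hle, h⟩ | h
  · simp [List.drop_eq_nil_of_le hle, extract, Thread.run] at h
  · exact h.2

/-- Functions computed by instruction sequences have circuits of at most quadratic size. -/
theorem Computes.hasCircuit {n : ℕ} {X : List PrimInstr} {f : (Fin n → Bool) → Bool}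
    (h : Computes X f) :
    HasCircuit n (n + (X.length + 1) * ((2 * X.length + 1) * HasCircuit.localCost 3)) {f} := by
  classical
  obtain ⟨l, hl⟩ := (computes_iff X f).1 h
  -- Only the registers mentioned in `X`, and the output register as `none`, are tracked. With the
  -- bits for the pending position this makes `2 * X.length + 1` columns, however many auxiliary
  -- registers there are.
  let foc : Option (Fin X.length) → Focus := fun o => o.elim .out fun i => X[i].focus
  let T : ℕ → (Fin n → Bool) → Fin X.length ⊕ Option (Fin X.length) → Bool := fun t x p =>
    p.elim (fun j : Fin X.length => decide ((execAt X (initRegs l x) t).1 = (j : ℕ)))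
      fun o => ((execAt X (initRegs l x) t).2 (foc o)).getD false
  have key := HasCircuit.tableau T 3 (fun p => ?_) (fun t p => ?_) X.length
  · refine key.mono ?_ ?_
    · simp only [Fintype.card_sum, Fintype.card_fin, Fintype.card_option]
      apply le_of_eq
      ring
    · rintro _ rfl
      exact ⟨.inr none, funext fun x => by simp [T, foc, execAt_length (hl x)]⟩
  · rcases p with j | o
    · exact ⟨∅, by simp, fun x y _ => rfl⟩
    · cases ho : foc o with
      | inp i =>
        by_cases hi : i < n
        · exact ⟨{⟨i, hi⟩}, by simp, fun x y hxy => by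
            simpa [T, execAt, ho, initRegs, hi] using hxy⟩
        · exact ⟨∅, by simp, fun x y _ => by simp [T, execAt, ho, initRegs, hi]⟩
      | aux i => exact ⟨∅, by simp, fun x y _ => by simp [T, execAt, ho, initRegs]⟩
      | out => exact ⟨∅, by simp, fun x y _ => by simp [T, execAt, ho, initRegs]⟩
  · by_cases ht : t < X.length
    -- A bit after handling position `t` depends on three bits: whether `t` is pending, the content
    -- of the register used there, and its own previous value.
    · refine ⟨{.inl ⟨t, ht⟩, .inr (some ⟨t, ht⟩), p}, Finset.card_le_three, fun x y hxy => ?_⟩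
      have h1 := hxy (.inl ⟨t, ht⟩) (by simp)
      have h2 := hxy (.inr (some ⟨t, ht⟩)) (by simp)
      have h3 := hxy p (by simp)
      simp only [T, Sum.elim_inl, Sum.elim_inr, decide_eq_decide, execAt,
        List.getElem?_eq_getElem ht] at h1 h2 h3 ⊢
      by_cases hx : (execAt X (initRegs l x) t).1 = t
      · have hy := h1.1 hx
        rw [if_pos hx, if_pos hy]
        have hr : X[t].replyOn (execAt X (initRegs l x) t).2 =
            X[t].replyOn (execAt X (initRegs l y) t).2 := by
          simp only [foc, Option.elim, Fin.getElem_fin, PrimInstr.focus] at h2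
          rcases hb : X[t].basic with _ | ⟨g, b | _⟩ <;> simp_all [PrimInstr.replyOn]
        rcases p with j | o
        · simp [hr]
        · simp only [Sum.elim_inr] at h3 ⊢
          rcases hb : X[t].basic with _ | ⟨g, b | _⟩
          · simpa [PrimInstr.effect, hb] using h3
          · simp only [PrimInstr.effect, hb]
            by_cases hg : foc o = g
            · simp [hg]
            · simpa [Function.update_of_ne hg] using h3
          · simpa [PrimInstr.effect, hb] using h3
      · rw [if_neg hx, if_neg fun hy => hx (h1.2 hy)]
        exact h3
    -- Beyond the end of `X` nothing changes; this case arises because `tableau` asks for locality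
    -- at every `t`.
    · refine ⟨{p}, by simp, fun x y hxy => ?_⟩
      have h3 := hxy p (by simp)
      simp only [T, execAt, List.getElem?_eq_none (not_lt.1 ht), ite_self] at h3 ⊢
      exact h3

/-! #### From circuits to instruction sequences -/

/-- The register holding the value of node `i` of a circuit with `n` inputs. -/
def nodeFocus (n i : ℕ) : Focus := if i < n then .inp i else .aux i

/-- Code storing the value of a gate in the auxiliary register with number `s`. -/
def gateCode (n : ℕ) {s : ℕ} : Gate s → List PrimInstr
  | .const b => [.plain ⟨.aux s, .set b⟩]
  | .not i => [.negTest ⟨nodeFocus n i, .get⟩, .plain ⟨.aux s, .set true⟩]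
  | .and i j => [.negTest ⟨nodeFocus n i, .get⟩, .jump 3, .posTest ⟨nodeFocus n j, .get⟩,
      .plain ⟨.aux s, .set true⟩]
  | .or i j => [.posTest ⟨nodeFocus n i, .get⟩, .jump 2, .posTest ⟨nodeFocus n j, .get⟩,
      .plain ⟨.aux s, .set true⟩]

/-- Code computing the values of all gates of a circuit. -/
def circuitCode {n : ℕ} : {s : ℕ} → Circuit n s → List PrimInstr
  | _, .inputs => []
  | _, .snoc C g => circuitCode C ++ gateCode n g

theorem Circuit.le_size {n s : ℕ} (C : Circuit n s) : n ≤ s := by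
  induction C <;> omega

/-- Since register `s` still contains `false`, the code for a non-constant gate only has to set it
when the value is true; otherwise it passes to `Y` without writing. In the conjunction `#3` leaves
the code, in the disjunction `#2` reaches the writing instruction. -/
theorem run_gateCode (n : ℕ) {s : ℕ} (g : Gate s) (Y : List PrimInstr) (ρ : Focus → Option Bool)
    (v : Fin s → Bool) (hv : ∀ i : Fin s, ρ (nodeFocus n i) = some (v i)) (hs : ρ (.aux s) = some false) :
    (extract (gateCode n g ++ Y)).run ρ =
      (extract Y).run (Function.update ρ (.aux s) (some (g.eval v))) := by
  have hup : Function.update ρ (.aux s) (some false) = ρ := by simp [← hs]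
  cases g with
  | const b => cases b <;> simp [gateCode, extract, Thread.run, hs, Gate.eval]
  | not i => cases hi : v i <;> simp [gateCode, extract, Thread.run, hs, Gate.eval, hv, hi, hup]
  | and i j =>
    cases hi : v i <;> cases hj : v j <;>
      simp [gateCode, extract, Thread.run, hs, Gate.eval, hv, hi, hj, hup]
  | or i j =>
    cases hi : v i <;> cases hj : v j <;>
      simp [gateCode, extract, Thread.run, hs, Gate.eval, hv, hi, hj, hup]

/-- The contents `ρ` do not depend on the continuation `Y`, so code for further gates can be
appended. The registers from `s` on are kept `false` for those gates. -/
theorem run_circuitCode {n s : ℕ} (C : Circuit n s) (l : ℕ) (hl : s ≤ l) (x : Fin n → Bool) :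
    ∃ ρ : Focus → Option Bool, ρ .out = some false ∧
      (∀ i : Fin s, ρ (nodeFocus n i) = some (C.eval x i)) ∧
      (∀ j, s ≤ j → j < l → ρ (.aux j) = some false) ∧
      ∀ Y, (extract (circuitCode C ++ Y)).run (initRegs l x) = (extract Y).run ρ := by
  induction C with
  | inputs =>
    refine ⟨initRegs l x, rfl, fun i => by simp [nodeFocus, initRegs, Circuit.eval],
      fun j _ hj => by simp [initRegs, hj], fun Y => rfl⟩
  | @snoc s C g ih =>
    obtain ⟨ρ, ho, hv, ha, hY⟩ := ih (by omega)
    have hn := C.le_size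
    refine ⟨Function.update ρ (.aux s) (some (g.eval (C.eval x))), by simp [ho], fun i => ?_,
      fun j hj hjl => ?_, fun Y => ?_⟩
    · refine Fin.lastCases ?_ (fun i => ?_) i
      · simp [nodeFocus, Circuit.eval, not_lt.2 hn]
      · have : nodeFocus n i ≠ .aux s := by
          have := i.2
          unfold nodeFocus
          split_ifs <;> simp
          omega
        simp [Function.update_of_ne this, hv, Circuit.eval]
    · have : Focus.aux j ≠ .aux s := by simp; omega
      simpa [Function.update_of_ne this] using ha j (by omega) hjl
    · rw [circuitCode, List.append_assoc, hY]
      exact run_gateCode n g Y ρ _ hv (ha s le_rfl (by omega))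

theorem length_circuitCode {n s : ℕ} (C : Circuit n s) : (circuitCode C).length ≤ 4 * s := by
  induction C with
  | inputs => simp [circuitCode]
  | snoc C g ih => cases g <;> simp [circuitCode, gateCode] <;> omega

theorem circuitCode_isAllowed {n s : ℕ} (C : Circuit n s) : ∀ u ∈ circuitCode C, u.IsAllowed := by
  have hn : ∀ i, (BasicInstr.mk (nodeFocus n i) .get).IsAllowed := by
    intro i
    unfold nodeFocus
    split_ifs <;> simp [BasicInstr.IsAllowed]
  induction C with
  | inputs => simp [circuitCode]
  | snoc C g ih =>
    intro u hu
    rw [circuitCode, List.mem_append] at hu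
    rcases hu with hu | hu
    · exact ih u hu
    · cases g <;> simp only [gateCode, List.mem_cons, List.not_mem_nil, or_false] at hu
      case const b => subst hu; trivial
      case not i => rcases hu with rfl | rfl; exacts [hn i, trivial]
      case and i j => rcases hu with rfl | rfl | rfl | rfl; exacts [hn i, trivial, hn j, trivial]
      case or i j => rcases hu with rfl | rfl | rfl | rfl; exacts [hn i, trivial, hn j, trivial]

/-- Functions with circuits are computed by instruction sequences of linear length. -/
theorem HasCircuit.exists_computes {n s : ℕ} {f : (Fin n → Bool) → Bool}
    (h : HasCircuit n s {f}) : ∃ X ∈ ISbr, Computes X f ∧ X.length ≤ 4 * s + 3 := by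
  obtain ⟨s', hs', C, hC⟩ := h
  obtain ⟨o, ho⟩ := hC f rfl
  refine ⟨circuitCode C ++ [.posTest ⟨nodeFocus n o, .get⟩, .plain ⟨.out, .set true⟩, .halt],
    ⟨by simp, ?_⟩, ?_, ?_⟩
  · intro u hu
    rw [List.mem_append] at hu
    rcases hu with hu | hu
    · exact circuitCode_isAllowed C u hu
    · simp only [List.mem_cons, List.not_mem_nil, or_false] at hu
      rcases hu with rfl | rfl | rfl <;> simp only [PrimInstr.IsAllowed]
      · unfold nodeFocus
        split_ifs <;> simp [BasicInstr.IsAllowed]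
      · simp [BasicInstr.IsAllowed]
  · rw [computes_iff]
    refine ⟨s', fun x => ?_⟩
    obtain ⟨ρ, hout, hv, -, hY⟩ := run_circuitCode C s' le_rfl x
    rw [hY]
    cases hfx : f x <;> simp [extract, Thread.run, hv, ho, hfx, hout]
  · have := length_circuitCode C
    simp
    omega

end NonuniformIS

namespace NonuniformIS

/-! ### Reduction of circuit satisfiability to 3SATC -/

theorem numDisj_strictMono : StrictMono numDisj := by
  intro a b h
  unfold numDisj
  have h1 : (2 * a).choose 1 < (2 * b).choose 1 := by simpa using h
  have h2 := Nat.choose_le_choose 2 (show 2 * a ≤ 2 * b by omega)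
  have h3 := Nat.choose_le_choose 3 (show 2 * a ≤ 2 * b by omega)
  omega

/-- 3SATC is queried only at the lengths `numDisj s`, where every input bit stands for a disjunction
over `s` variables. -/
theorem numVars_numDisj (s : ℕ) : numVars (numDisj s) = s := by
  unfold numVars
  rw [Nat.findGreatest_eq_iff]
  exact ⟨numDisj_strictMono.le_apply, fun _ => le_rfl,
    fun m hm _ => not_le.2 (numDisj_strictMono hm)⟩

theorem numDisj_numVars_le (n : ℕ) : numDisj (numVars n) ≤ n :=
  Nat.findGreatest_spec (P := fun k => numDisj k ≤ n) (Nat.zero_le n) (by simp [numDisj])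

theorem polyBound_numDisj : PolyBound numDisj := by
  refine ((((PolyBound.const 2).mul .id).pow 1).add (((PolyBound.const 2).mul .id).pow 2)).add
    (((PolyBound.const 2).mul .id).pow 3) |>.mono fun k => ?_
  unfold numDisj
  gcongr <;> exact Nat.choose_le_pow _ _

/-- Truth of a disjunction. -/
def ClauseHolds (σ : ℕ → Bool) (L : Finset Literal) : Prop := ∃ l ∈ L, Literal.Holds σ l

@[simp]
theorem clauseHolds_singleton (σ : ℕ → Bool) (l : Literal) :
    ClauseHolds σ {l} ↔ σ l.1 = l.2 := by
  simp only [ClauseHolds, Finset.mem_singleton, exists_eq_left, Literal.Holds]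

@[simp]
theorem clauseHolds_insert (σ : ℕ → Bool) (l : Literal) (L : Finset Literal) :
    ClauseHolds σ (insert l L) ↔ σ l.1 = l.2 ∨ ClauseHolds σ L := by
  simp only [ClauseHolds, Finset.mem_insert, exists_eq_or_imp, Literal.Holds]

/-- Disjunctions expressing that variable `s` has the value of a gate. -/
def gateClauses {s : ℕ} : Gate s → List (Finset Literal)
  | .const b => [{(s, b)}]
  | .not i => [{(s, true), (↑i, true)}, {(s, false), (↑i, false)}]
  | .and i j => [{(s, false), (↑i, true)}, {(s, false), (↑j, true)},
      {(s, true), (↑i, false), (↑j, false)}]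
  | .or i j => [{(s, true), (↑i, false)}, {(s, true), (↑j, false)},
      {(s, false), (↑i, true), (↑j, true)}]

/-- Disjunctions expressing that the variables have the values of the nodes of a circuit. -/
def circuitClauses {n : ℕ} : {s : ℕ} → Circuit n s → List (Finset Literal)
  | _, .inputs => []
  | _, .snoc C g => circuitClauses C ++ gateClauses g

theorem gateClauses_hold_iff {s : ℕ} (g : Gate s) (σ : ℕ → Bool) :
    (∀ L ∈ gateClauses g, ClauseHolds σ L) ↔ σ s = g.eval fun i => σ i := by
  cases g with
  | const b => simp [gateClauses, Gate.eval]
  | not i => cases hs : σ s <;> cases hi : σ i <;> simp [gateClauses, Gate.eval, hs, hi]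
  | and i j =>
    cases hs : σ s <;> cases hi : σ i <;> cases hj : σ j <;>
      simp [gateClauses, Gate.eval, hs, hi, hj]
  | or i j =>
    cases hs : σ s <;> cases hi : σ i <;> cases hj : σ j <;>
      simp [gateClauses, Gate.eval, hs, hi, hj]

/-- Tseitin encoding: there is one variable per node and the input variables are unconstrained, so
satisfying assignments correspond to evaluations of the circuit. -/
theorem circuitClauses_hold_iff {n s : ℕ} (C : Circuit n s) (σ : ℕ → Bool) :
    (∀ L ∈ circuitClauses C, ClauseHolds σ L) ↔
      ∀ j : Fin s, σ j = C.eval (fun i : Fin n => σ i) j := by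
  induction C with
  | inputs => simp [circuitClauses, Circuit.eval]
  | @snoc s C g ih =>
    simp only [circuitClauses, List.mem_append, or_imp, forall_and, ih, gateClauses_hold_iff,
      Fin.forall_fin_succ', Circuit.eval, Fin.snoc_castSucc, Fin.snoc_last, Fin.val_castSucc,
      Fin.val_last]
    refine and_congr_right fun h => ?_
    rw [show (fun i : Fin s => σ i) = C.eval fun i : Fin n => σ i from funext h]

theorem disjSets_mono {a b : ℕ} (h : a ≤ b) : disjSets a ⊆ disjSets b :=
  fun _ hL => ⟨fun l hl => (hL.1 l hl).trans_le h, hL.2⟩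

theorem singleton_mem_disjSets {l : Literal} {s : ℕ} (h : l.1 < s) : {l} ∈ disjSets s :=
  ⟨by simpa only [Finset.mem_singleton, forall_eq] using h, by simp, by simp⟩

/-- The two predecessors of a gate may coincide, in which case a disjunction has fewer literals than
written; hence only bounds on the cardinality are used. -/
theorem gateClauses_subset {s : ℕ} (g : Gate s) : ∀ L ∈ gateClauses g, L ∈ disjSets (s + 1) := by
  intro L hL
  have hc2 : ∀ a b : Literal, a.1 < s + 1 → b.1 < s + 1 → {a, b} ∈ disjSets (s + 1) :=
    fun a b ha hb => ⟨by simpa only [Finset.mem_insert, Finset.mem_singleton, forall_eq_or_imp,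
      forall_eq] using ⟨ha, hb⟩, Finset.card_pos.2 ⟨a, by simp⟩,
      Finset.card_le_two.trans (by norm_num)⟩
  have hc3 : ∀ a b c : Literal, a.1 < s + 1 → b.1 < s + 1 → c.1 < s + 1 →
      {a, b, c} ∈ disjSets (s + 1) :=
    fun a b c ha hb hc => ⟨by simpa only [Finset.mem_insert, Finset.mem_singleton,
      forall_eq_or_imp, forall_eq] using ⟨ha, hb, hc⟩, Finset.card_pos.2 ⟨a, by simp⟩,
      Finset.card_le_three⟩
  have hi : ∀ i : Fin s, (i : ℕ) < s + 1 := fun i => i.2.trans (Nat.lt_succ_self s)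
  have hs := Nat.lt_succ_self s
  cases g <;> simp only [gateClauses, List.mem_cons, List.not_mem_nil, or_false] at hL
  case const b => exact hL ▸ singleton_mem_disjSets hs
  case not i => rcases hL with rfl | rfl <;> exact hc2 _ _ hs (hi i)
  case and i j =>
    rcases hL with rfl | rfl | rfl
    exacts [hc2 _ _ hs (hi i), hc2 _ _ hs (hi j), hc3 _ _ _ hs (hi i) (hi j)]
  case or i j =>
    rcases hL with rfl | rfl | rfl
    exacts [hc2 _ _ hs (hi i), hc2 _ _ hs (hi j), hc3 _ _ _ hs (hi i) (hi j)]

theorem circuitClauses_subset {n s : ℕ} (C : Circuit n s) :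
    ∀ L ∈ circuitClauses C, L ∈ disjSets s := by
  induction C with
  | inputs => simp [circuitClauses]
  | snoc C g ih =>
    intro L hL
    rw [circuitClauses, List.mem_append] at hL
    rcases hL with hL | hL
    · exact disjSets_mono (Nat.le_succ _) (ih L hL)
    · exact gateClauses_subset g L hL

/-- 3SATC on the indicator function of a set of disjunctions. -/
theorem threeSATC_indicator (α : DisjNumbering) (s : ℕ) (P : Finset Literal → Prop)
    (hP : ∀ L, P L → L ∈ disjSets s) (b : Fin (numDisj s) → Bool)
    (hb : ∀ j, b j = true ↔ P (α.disj s j)) :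
    threeSATC α (numDisj s) b = true ↔ ∃ σ, ∀ L, P L → ClauseHolds σ L := by
  simp only [threeSATC, decide_eq_true_iff, numVars_numDisj]
  refine exists_congr fun σ => ⟨fun h L hL => ?_, fun h i _ hi => h _ ((hb i).1 hi)⟩
  obtain ⟨j, hj, rfl⟩ := (α.bijOn s).surjOn (hP L hL)
  exact h ⟨j, hj⟩ hj ((hb _).2 hL)

/-- If 3SATC has polynomial-length instruction sequences, then languages with polynomial-size
nondeterministic circuits have polynomial-size circuits. -/
theorem mem_PPoly_of_nondeterministic {α : DisjNumbering} (hα : threeSATC α ∈ PLIS)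
    {L : Language Bool} {p : ℕ → ℕ} (hp : PolyBound p)
    (hL : ∀ n, ∃ (h : ℕ) (g : (Fin (n + h) → Bool) → Bool), HasCircuit (n + h) (p n) {g} ∧
      ∀ x : Fin n → Bool, List.ofFn x ∈ L ↔ ∃ u, g (Fin.append x u) = true) : L ∈ PPoly := by
  classical
  obtain ⟨q, hq, hX⟩ := hα
  -- The circuit size `s` is known only to be at most `p n`, so the length bound must be monotone to
  -- be evaluated at `numDisj (p n)`.
  obtain ⟨q, hqm, hqp, hle⟩ := (PolyBound.of_mem_poly hq).exists_monotone
  rw [mem_PPoly_iff]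
  have hM : PolyBound fun n => numDisj (p n) := polyBound_numDisj.comp hp
  have hQ : PolyBound fun n => q (numDisj (p n)) := hqp.comp hM
  refine ⟨fun n => n + numDisj (p n) * HasCircuit.localCost 1 + (numDisj (p n) +
    (q (numDisj (p n)) + 1) * ((2 * q (numDisj (p n)) + 1) * HasCircuit.localCost 3)),
    (PolyBound.id.add (hM.mul (.const _))).add (hM.add ((hQ.add (.const 1)).mul
      ((((PolyBound.const 2).mul hQ).add (.const 1)).mul (.const _)))), fun n => ?_⟩
  obtain ⟨h, g, ⟨s, hs, C, hC⟩, hg⟩ := hL n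
  obtain ⟨o, ho⟩ := hC g rfl
  obtain ⟨X, -, hcomp, hlen⟩ := hX (numDisj s)
  -- The clauses of the circuit, the demand that its output be true, and unit clauses fixing the
  -- first `n` inputs to `x`. The other `h` inputs stay free and play the role of the certificate.
  let P : (Fin n → Bool) → Finset Literal → Prop := fun x L =>
    L ∈ circuitClauses C ∨ L = {((o : ℕ), true)} ∨ ∃ i : Fin n, L = {((i : ℕ), x i)}
  let π : (Fin n → Bool) → Fin (numDisj s) → Bool := fun x j => decide (P x (α.disj s j))
  have hns := C.le_size
  refine ⟨fun x => threeSATC α (numDisj s) (π x), ?_, fun x => ?_⟩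
  · refine (hcomp.hasCircuit.subst_projection π fun j => ?_).mono ?_ le_rfl
    -- Whether a given disjunction occurs depends on `x` only if it is a single literal over an
    -- input variable, and then on that input alone.
    · by_cases hj : ∃ (i : Fin n) (b : Bool), α.disj s j = {((i : ℕ), b)}
      · obtain ⟨i, b, hib⟩ := hj
        refine ⟨{i}, by simp, fun x y hxy => ?_⟩
        have hxy : x i = y i := hxy i (by simp)
        simp only [π, P, hib, decide_eq_decide]
        refine or_congr_right (or_congr_right (exists_congr fun k => ?_))
        simp only [Finset.singleton_inj, Prod.mk.injEq]
        refine and_congr_right fun hk => ?_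
        rw [← Fin.ext hk, hxy]
      · have hx : ∀ x : Fin n → Bool, ¬ ∃ i : Fin n, α.disj s j = {((i : ℕ), x i)} :=
          fun x ⟨i, hi⟩ => hj ⟨i, _, hi⟩
        exact ⟨∅, by simp, fun x y _ => by simp only [π, P, hx]⟩
    · have h1 : numDisj s ≤ numDisj (p n) := numDisj_strictMono.monotone hs
      have h2 : X.length ≤ q (numDisj (p n)) := hlen.trans ((hle _).trans (hqm h1))
      beta_reduce
      gcongr
  · rw [threeSATC_indicator α s (P x) ?_ (π x) (fun j => by simp [π]), hg]
    · constructor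
      · rintro ⟨σ, hσ⟩
        have h1 := (circuitClauses_hold_iff C σ).1 fun L hL => hσ L (.inl hL)
        have h2 : σ o = true := by
          simpa using hσ _ (.inr (.inl rfl))
        have h3 : ∀ i : Fin n, σ i = x i := fun i => by
          simpa using hσ _ (.inr (.inr ⟨i, rfl⟩))
        refine ⟨fun j => σ (n + j), ?_⟩
        rw [← ho, ← h2, h1]
        congr 1
        funext i
        refine Fin.addCases (fun i => ?_) (fun i => ?_) i
        · simp [h3]
        · simp
      · rintro ⟨u, hu⟩
        let σ : ℕ → Bool := fun j =>
          if hj : j < s then C.eval (Fin.append x u) ⟨j, hj⟩ else false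
        have hin : ∀ i : Fin (n + h), σ i = Fin.append x u i := by
          intro i
          have hi : (i : ℕ) < s := i.2.trans_le hns
          have key : ∀ {s : ℕ} (C : Circuit (n + h) s) (hi : (i : ℕ) < s),
              C.eval (Fin.append x u) ⟨i, hi⟩ = Fin.append x u i := by
            intro s C
            induction C with
            | inputs => intro hi; rfl
            | @snoc s C g ih =>
              intro hi
              have hi' : (i : ℕ) < s := i.2.trans_le C.le_size
              rw [← ih hi']
              exact Fin.snoc_castSucc (α := fun _ => Bool) _ _ ⟨i, hi'⟩
          simp [σ, hi, key]
        refine ⟨σ, ?_⟩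
        rintro L (hL | rfl | ⟨i, rfl⟩)
        · refine (circuitClauses_hold_iff C σ).2 (fun j => ?_) L hL
          rw [funext hin]
          simp [σ]
        · simp [σ, ho, hu]
        · simpa using hin (Fin.castAdd h i)
    · rintro L (hL | rfl | ⟨i, rfl⟩)
      · exact circuitClauses_subset C L hL
      · exact singleton_mem_disjSets o.2
      · exact singleton_mem_disjSets (by have := i.2; simp only; omega)

end NonuniformIS

namespace NonuniformIS

open Turing

/-! ### Simulation of stack machines by circuits -/

section TM2

variable {K : Type} {Γ : K → Type} {Λ σ : Type}

/-- The number of stack operations in a statement. -/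
def stmtDepth : TM2.Stmt Γ Λ σ → ℕ
  | .push _ _ q => stmtDepth q + 1
  | .peek _ _ q => stmtDepth q + 1
  | .pop _ _ q => stmtDepth q + 1
  | .load _ q => stmtDepth q
  | .branch _ q₁ q₂ => stmtDepth q₁ + stmtDepth q₂
  | .goto _ => 0
  | .halt => 0

open Classical in
/-- The symbols that can be pushed by a statement. -/
noncomputable def stmtSymbols [Fintype σ] : TM2.Stmt Γ Λ σ → Finset (Σ k, Γ k)
  | .push k f q => Finset.univ.image (fun v => (⟨k, f v⟩ : Σ k, Γ k)) ∪ stmtSymbols q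
  | .peek _ _ q => stmtSymbols q
  | .pop _ _ q => stmtSymbols q
  | .load _ q => stmtSymbols q
  | .branch _ q₁ q₂ => stmtSymbols q₁ ∪ stmtSymbols q₂
  | .goto _ => ∅
  | .halt => ∅

/-- The stacks agree at depth below `D` and at distance at most `D` from depth `i`. -/
def AgreeNear (D i : ℕ) (S S' : ∀ k, List (Γ k)) : Prop :=
  ∀ k j, (j < D ∨ (i ≤ j + D ∧ j ≤ i + D)) → (S k)[j]? = (S' k)[j]?

theorem AgreeNear.mono {D E i : ℕ} {S S' : ∀ k, List (Γ k)} (h : AgreeNear E i S S')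
    (hDE : D ≤ E) : AgreeNear D i S S' :=
  fun k j hj => h k j (by omega)

theorem AgreeNear.head? {D i : ℕ} {S S' : ∀ k, List (Γ k)} (h : AgreeNear (D + 1) i S S') (k : K) :
    (S k).head? = (S' k).head? := by
  simpa [List.head?_eq_getElem?] using h k 0 (by omega)

/-- All stack symbols are in `A`. -/
def SymbolsIn (A : Finset (Σ k, Γ k)) (S : ∀ k, List (Γ k)) : Prop :=
  ∀ k, ∀ a ∈ S k, (⟨k, a⟩ : Σ k, Γ k) ∈ A

open Classical in
/-- The bits describing a configuration whose stacks have height at most `H`. -/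
noncomputable def cfgBit (A : Finset (Σ k, Γ k)) (H : ℕ) (c : TM2.Cfg Γ Λ σ) :
    Option Λ ⊕ σ ⊕ A × Fin H → Bool
  | .inl l => decide (c.l = l)
  | .inr (.inl v) => decide (c.var = v)
  | .inr (.inr (a, i)) => decide ((c.stk a.1.1)[(i : ℕ)]? = some a.1.2)

/-- The bits only tell which symbol of `A` a cell holds. As no other symbols occur, they determine
the cell, including whether it is empty. -/
theorem cell_eq_of_cfgBit {A : Finset (Σ k, Γ k)} {H : ℕ} {c c' : TM2.Cfg Γ Λ σ}
    (hc : SymbolsIn A c.stk) (hc' : SymbolsIn A c'.stk) (k : K) (i : Fin H)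
    (h : ∀ a, cfgBit A H c (.inr (.inr (a, i))) = cfgBit A H c' (.inr (.inr (a, i)))) :
    (c.stk k)[(i : ℕ)]? = (c'.stk k)[(i : ℕ)]? := by
  ext a
  constructor <;> intro ha
  · have := h ⟨⟨k, a⟩, hc k a (List.mem_of_getElem? ha)⟩
    simp only [cfgBit, decide_eq_decide] at this
    exact this.1 ha
  · have := h ⟨⟨k, a⟩, hc' k a (List.mem_of_getElem? ha)⟩
    simp only [cfgBit, decide_eq_decide] at this
    exact this.2 ha

variable [DecidableEq K]

theorem AgreeNear.push {D i : ℕ} {S S' : ∀ k, List (Γ k)} (h : AgreeNear (D + 1) i S S') (k : K)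
    (a : Γ k) :
    AgreeNear D i (Function.update S k (a :: S k)) (Function.update S' k (a :: S' k)) := by
  intro k' j hj
  by_cases hk : k' = k
  · subst hk
    cases j with
    | zero => simp
    | succ j => simpa using h k' j (by omega)
  · simpa [Function.update_of_ne hk] using h k' j (by omega)

theorem AgreeNear.pop {D i : ℕ} {S S' : ∀ k, List (Γ k)} (h : AgreeNear (D + 1) i S S') (k : K) :
    AgreeNear D i (Function.update S k (S k).tail) (Function.update S' k (S' k).tail) := by
  intro k' j hj
  by_cases hk : k' = k
  · subst hk
    simpa using h k' (j + 1) (by omega)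
  · simpa [Function.update_of_ne hk] using h k' j (by omega)

/-- A statement with at most `D` stack operations inspects cells at depth below `D` only and moves a
symbol by at most `D`. So a cell at depth `i` depends on a window at the top and one around `i`;
each operation narrows both by one. -/
theorem stepAux_congr {i : ℕ} (q : TM2.Stmt Γ Λ σ) (v : σ) (S S' : ∀ k, List (Γ k)) {D : ℕ}
    (hq : stmtDepth q ≤ D) (h : AgreeNear D i S S') :
    (TM2.stepAux q v S).l = (TM2.stepAux q v S').l ∧
    (TM2.stepAux q v S).var = (TM2.stepAux q v S').var ∧
    ∀ k, ((TM2.stepAux q v S).stk k)[i]? = ((TM2.stepAux q v S').stk k)[i]? := by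
  induction q generalizing v S S' D with
  | push k f q ih =>
    obtain ⟨D, rfl⟩ : ∃ E, D = E + 1 := ⟨D - 1, by simp only [stmtDepth] at hq; omega⟩
    exact ih _ _ _ (by simpa [stmtDepth] using hq) (h.push k _)
  | peek k f q ih =>
    obtain ⟨D, rfl⟩ : ∃ E, D = E + 1 := ⟨D - 1, by simp only [stmtDepth] at hq; omega⟩
    simp only [TM2.stepAux, h.head? k]
    exact ih _ _ _ (by simpa [stmtDepth] using hq) (h.mono (Nat.le_succ D))
  | pop k f q ih =>
    obtain ⟨D, rfl⟩ : ∃ E, D = E + 1 := ⟨D - 1, by simp only [stmtDepth] at hq; omega⟩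
    simp only [TM2.stepAux, h.head? k]
    exact ih _ _ _ (by simpa [stmtDepth] using hq) (h.pop k)
  | load a q ih => exact ih _ _ _ hq h
  | branch f q₁ q₂ ih₁ ih₂ =>
    simp only [stmtDepth] at hq
    simp only [TM2.stepAux]
    cases f v
    · exact ih₂ _ _ _ (by omega) h
    · exact ih₁ _ _ _ (by omega) h
  | goto l => exact ⟨rfl, rfl, fun k => h k i (by omega)⟩
  | halt => exact ⟨rfl, rfl, fun k => h k i (by omega)⟩

theorem length_stepAux_le (q : TM2.Stmt Γ Λ σ) (v : σ) (S : ∀ k, List (Γ k)) (k : K) :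
    ((TM2.stepAux q v S).stk k).length ≤ (S k).length + stmtDepth q := by
  induction q generalizing v S with
  | push k' f q ih =>
    refine (ih _ _).trans ?_
    by_cases hk : k = k'
    · subst hk
      simp [stmtDepth]
      omega
    · simp [stmtDepth, Function.update_of_ne hk]
  | peek k' f q ih => exact (ih _ _).trans (by simp [stmtDepth])
  | pop k' f q ih =>
    refine (ih _ _).trans ?_
    by_cases hk : k = k'
    · subst hk
      simp [stmtDepth]
      omega
    · simp [stmtDepth, Function.update_of_ne hk]
  | load a q ih => exact ih _ _
  | branch f q₁ q₂ ih₁ ih₂ =>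
    simp only [TM2.stepAux, stmtDepth]
    cases f v
    · exact (ih₂ _ _).trans (by omega)
    · exact (ih₁ _ _).trans (by omega)
  | goto l => simp [TM2.stepAux]
  | halt => simp [TM2.stepAux]

theorem SymbolsIn.stepAux [Fintype σ] {A : Finset (Σ k, Γ k)} (q : TM2.Stmt Γ Λ σ)
    (hq : stmtSymbols q ⊆ A) (v : σ) {S : ∀ k, List (Γ k)} (h : SymbolsIn A S) :
    SymbolsIn A (TM2.stepAux q v S).stk := by
  classical
  induction q generalizing v S with
  | push k' f q ih =>
    simp only [stmtSymbols, Finset.union_subset_iff] at hq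
    refine ih hq.2 _ fun k a ha => ?_
    by_cases hk : k = k'
    · subst hk
      simp only [Function.update_self, List.mem_cons] at ha
      rcases ha with rfl | ha
      · exact hq.1 (by simp)
      · exact h k a ha
    · rw [Function.update_of_ne hk] at ha
      exact h k a ha
  | peek k' f q ih => exact ih hq _ h
  | pop k' f q ih =>
    refine ih hq _ fun k a ha => ?_
    by_cases hk : k = k'
    · subst hk
      rw [Function.update_self] at ha
      exact h k a (List.mem_of_mem_tail ha)
    · rw [Function.update_of_ne hk] at ha
      exact h k a ha
  | load a q ih => exact ih hq _ h
  | branch f q₁ q₂ ih₁ ih₂ =>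
    simp only [stmtSymbols, Finset.union_subset_iff] at hq
    simp only [TM2.stepAux]
    cases f v
    · exact ih₂ hq.2 _ h
    · exact ih₁ hq.1 _ h
  | goto l => exact h
  | halt => exact h

/-- One step of a machine; halting configurations do not change. -/
def nextCfg (M : Λ → TM2.Stmt Γ Λ σ) (c : TM2.Cfg Γ Λ σ) : TM2.Cfg Γ Λ σ :=
  match c.l with
  | none => c
  | some l => TM2.stepAux (M l) c.var c.stk

theorem nextCfg_iterate_of_evals {M : Λ → TM2.Stmt Γ Λ σ} {c c' : TM2.Cfg Γ Λ σ} {t : ℕ}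
    (h : (flip bind (TM2.step M))^[t] (some c) = some c') : (nextCfg M)^[t] c = c' := by
  induction t generalizing c with
  | zero => simpa using h
  | succ t ih =>
    rw [Function.iterate_succ_apply] at h ⊢
    obtain ⟨l, v, S⟩ := c
    cases l with
    | none =>
      have hn : ∀ t, (flip bind (TM2.step M))^[t] none = none := fun t =>
        Function.iterate_fixed rfl t
      have : flip bind (TM2.step M) (some ⟨none, v, S⟩) = none := rfl
      rw [this, hn] at h
      cases h
    | some l => exact ih h

/-- Because halting configurations are fixed by `nextCfg`, one step count `T` serves all inputs of a
given length, whenever they halt. -/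
theorem nextCfg_iterate_le {M : Λ → TM2.Stmt Γ Λ σ} {c c' : TM2.Cfg Γ Λ σ} {t T : ℕ} (htT : t ≤ T)
    (h : (flip bind (TM2.step M))^[t] (some c) = some c') (hc' : c'.l = none) :
    (nextCfg M)^[T] c = c' := by
  obtain ⟨r, rfl⟩ := Nat.exists_eq_add_of_le htT
  rw [add_comm, Function.iterate_add_apply, nextCfg_iterate_of_evals h]
  exact Function.iterate_fixed (by simp [nextCfg, hc']) r

/-- At most `D` cells at the top and `2 * D + 1` around `i`; the bound does not depend on the height
`H`, so the cost of each tableau bit is constant. -/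
theorem card_window_le (H D i : ℕ) :
    (Finset.univ.filter fun j : Fin H => (j : ℕ) < D ∨ (i ≤ j + D ∧ (j : ℕ) ≤ i + D)).card ≤
      3 * D + 1 := by
  have : (Finset.univ.filter fun j : Fin H =>
      (j : ℕ) < D ∨ (i ≤ j + D ∧ (j : ℕ) ≤ i + D)).map Fin.valEmbedding ⊆
      Finset.range D ∪ Finset.Icc (i - D) (i + D) := by
    intro j
    simp only [Finset.mem_map, Finset.mem_filter, Finset.mem_univ, true_and,
      Fin.valEmbedding_apply, Finset.mem_union, Finset.mem_range, Finset.mem_Icc]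
    rintro ⟨j, hj, rfl⟩
    omega
  have := (Finset.card_le_card this).trans (Finset.card_union_le _ _)
  simp only [Finset.card_map, Finset.card_range, Nat.card_Icc] at this
  omega

/-- Polynomial-size circuits for the content of the top of a stack after `T` steps. -/
theorem hasCircuit_cfg [Fintype Λ] [Fintype σ] (M : Λ → TM2.Stmt Γ Λ σ) (A : Finset (Σ k, Γ k))
    (hA : ∀ l, stmtSymbols (M l) ⊆ A) (D : ℕ) (hD : ∀ l, stmtDepth (M l) ≤ D) {n : ℕ}
    (init : (Fin n → Bool) → TM2.Cfg Γ Λ σ) (T H : ℕ)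
    (hH : ∀ x k, ((init x).stk k).length + T * D < H)
    (hsym : ∀ x, SymbolsIn A (init x).stk)
    (hl : ∀ x y, (init x).l = (init y).l) (hv : ∀ x y, (init x).var = (init y).var)
    (hstk : ∀ (k : K) (i : ℕ), ∃ J : Finset (Fin n), J.card ≤ 1 ∧ ∀ x y, (∀ j ∈ J, x j = y j) →
      ((init x).stk k)[i]? = ((init y).stk k)[i]?)
    (k : K) (f : (Fin n → Bool) → Bool) (a : Γ k) (ha : (⟨k, a⟩ : Σ k, Γ k) ∈ A)
    (hf : ∀ x, f x = true ↔ (((nextCfg M)^[T] (init x)).stk k)[0]? = some a) :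
    HasCircuit n (n + (T + 1) * ((Fintype.card Λ + 1 + (Fintype.card σ + A.card * H)) *
      HasCircuit.localCost
        (Fintype.card Λ + 1 + (Fintype.card σ + A.card * (3 * D + 1)))))  {f} := by
  classical
  set m := Fintype.card Λ + 1 + (Fintype.card σ + A.card * (3 * D + 1)) with hm
  by_cases hn : T * D < H
  swap
  · exact absurd (lt_of_le_of_lt (Nat.le_add_left _ _) (hH (fun _ => false) k)) hn
  have hH0 : 0 < H := by omega
  -- Frozen after `T` steps: stack heights are bounded by `H` only that far, whereas `tableau`
  -- considers every `t`.
  let c : ℕ → (Fin n → Bool) → TM2.Cfg Γ Λ σ := fun t x => (nextCfg M)^[min t T] (init x)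
  have hsymc : ∀ t x, SymbolsIn A ((nextCfg M)^[t] (init x)).stk := by
    intro t x
    induction t with
    | zero => exact hsym x
    | succ t ih =>
      rw [Function.iterate_succ_apply']
      generalize (nextCfg M)^[t] (init x) = c at ih ⊢
      unfold nextCfg
      cases c.l with
      | none => exact ih
      | some l => exact ih.stepAux _ (hA l) _
  have hlen : ∀ t x k,
      (((nextCfg M)^[t] (init x)).stk k).length ≤ ((init x).stk k).length + t * D := by
    intro t x k
    induction t with
    | zero => simp
    | succ t ih =>
      rw [Function.iterate_succ_apply']
      generalize (nextCfg M)^[t] (init x) = c at ih ⊢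
      unfold nextCfg
      cases c.l with
      | none => exact ih.trans (by gcongr; omega)
      | some l =>
        have := length_stepAux_le (M l) c.var c.stk k
        have := hD l
        simp only
        rw [Nat.succ_mul]
        omega
  have hlenc : ∀ t x k, ((c t x).stk k).length < H := by
    intro t x k
    refine lt_of_le_of_lt (hlen _ x k) (lt_of_le_of_lt ?_ (hH x k))
    gcongr
    exact min_le_right _ _
  have key := HasCircuit.tableau (fun t x p => cfgBit A H (c t x) p) m (fun p => ?_)
    (fun t p => ?_) T
  · refine key.mono ?_ ?_
    · simp [Fintype.card_sum, Fintype.card_option, Fintype.card_prod]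
    · rintro _ rfl
      refine ⟨.inr (.inr (⟨⟨k, a⟩, ha⟩, ⟨0, hH0⟩)), funext fun x => ?_⟩
      rw [Bool.eq_iff_iff, hf]
      simp [cfgBit, c]
  · rcases p with l | v | ⟨a, i⟩
    · exact ⟨∅, by simp, fun x y _ => by simp [cfgBit, c, hl x y]⟩
    · exact ⟨∅, by simp, fun x y _ => by simp [cfgBit, c, hv x y]⟩
    · obtain ⟨J, hJ, h⟩ := hstk a.1.1 i
      refine ⟨J, by omega, fun x y hxy => ?_⟩
      simp [cfgBit, c, h x y hxy]
  -- The depth of the cell described by `p`. For label and variable bits the depth is irrelevant and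
  -- taken to be `0`.
  · let i : ℕ := match p with
      | .inr (.inr (_, i)) => i
      | _ => 0
    refine ⟨Finset.univ.disjSum (Finset.univ.disjSum (Finset.univ ×ˢ
      (Finset.univ.filter fun j : Fin H => (j : ℕ) < D ∨ (i ≤ j + D ∧ (j : ℕ) ≤ i + D)))),
      ?_, fun x y hxy => ?_⟩
    · simp only [Finset.card_disjSum, Finset.card_univ, Finset.card_product, Fintype.card_option,
        Fintype.card_coe, hm]
      gcongr
      exact card_window_le H D i
    · have hlab : (c t x).l = (c t y).l := by
        have := hxy (.inl (c t y).l) (by simp)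
        simpa [cfgBit] using this
      have hvar : (c t x).var = (c t y).var := by
        have := hxy (.inr (.inl (c t y).var)) (by simp)
        simpa [cfgBit] using this
      have hagree : AgreeNear D i (c t x).stk (c t y).stk := by
        intro k j hj
        by_cases hjH : j < H
        · exact cell_eq_of_cfgBit (hsymc _ x) (hsymc _ y) k ⟨j, hjH⟩ fun a =>
            hxy (.inr (.inr (a, ⟨j, hjH⟩))) (by simpa using hj)
        -- Cells at depth `H` or more have no bits in the tableau, but they are empty in both
        -- configurations.
        · rw [List.getElem?_eq_none, List.getElem?_eq_none]
          · have := hlenc t y k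
            omega
          · have := hlenc t x k
            omega
      have hnext : (c (t + 1) x).l = (c (t + 1) y).l ∧ (c (t + 1) x).var = (c (t + 1) y).var ∧
          ∀ k, ((c (t + 1) x).stk k)[i]? = ((c (t + 1) y).stk k)[i]? := by
        rcases lt_or_ge t T with htT | htT
        · have hc : ∀ x, c (t + 1) x = nextCfg M (c t x) := fun x => by
            simp only [c, min_eq_left htT.le, min_eq_left (Nat.succ_le_of_lt htT),
              Function.iterate_succ_apply']
          rw [hc, hc]
          unfold nextCfg
          rw [← hlab]
          cases (c t x).l with
          | none => exact ⟨hlab, hvar, fun k => hagree k i (by omega)⟩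
          | some l =>
            simp only
            rw [← hvar]
            exact stepAux_congr (M l) _ _ _ (hD l) hagree
        · have hc : ∀ x, c (t + 1) x = c t x := fun x => by
            simp only [c, min_eq_right htT, min_eq_right (htT.trans (Nat.le_succ t))]
          rw [hc, hc]
          exact ⟨hlab, hvar, fun k => hagree k i (by omega)⟩
      rcases p with l | v | ⟨a, j⟩
      · simp [cfgBit, hnext.1]
      · simp [cfgBit, hnext.2.1]
      · have := hnext.2.2 a.1.1
        simp only [i] at this
        simp [cfgBit, this]

end TM2

/-- A pair is encoded by tagging the bits of its components, so each cell of the initial input stack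
is determined by a single bit of word or certificate. -/
theorem map_encode_append {Γ₀ : Type} (e : Bool ⊕ Bool → Γ₀) {n h : ℕ} (z : Fin (n + h) → Bool) :
    ((Computability.encodingProd (Computability.encodingList Bool)
      (Computability.encodingList Bool)).encode
        (List.ofFn fun i : Fin n => z (i.castAdd h), List.ofFn fun i : Fin h => z (i.natAdd n))).map
          e =
      List.ofFn fun i : Fin (n + h) => e (if (i : ℕ) < n then .inl (z i) else .inr (z i)) := by
  have : (fun i : Fin (n + h) => e (if (i : ℕ) < n then .inl (z i) else .inr (z i))) =
      Fin.append (fun i : Fin n => e (.inl (z (i.castAdd h))))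
        (fun i : Fin h => e (.inr (z (i.natAdd n)))) := by
    funext i
    refine Fin.addCases (fun i => ?_) (fun i => ?_) i <;> simp
  rw [this, List.ofFn_fin_append]
  simp [Computability.encodingProd, Computability.encodingList, List.map_ofFn, Function.comp_def]

/-- If 3SATC has polynomial-length instruction sequences, then every language in NP has
polynomial-size circuits. -/
theorem NP_subset_PPoly {α : DisjNumbering} (hα : threeSATC α ∈ PLIS) : NP ⊆ PPoly := by
  classical
  rintro L ⟨h, hh, V, ⟨⟨⟨tm, ein, eout⟩, time, outputs⟩⟩, hL⟩
  have hp := PolyBound.of_mem_poly hh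
  let _ := tm.ΛFin
  let _ := tm.σFin
  let _ := tm.Γk₀Fin
  let D := ∑ l : tm.Λ, stmtDepth (tm.m l)
  -- Only the input alphabet is known to be finite. The symbols that matter are those the program
  -- can push, the input symbols, and the symbol for the answer `true`.
  let A : Finset (Σ k, tm.Γ k) := (Finset.univ.biUnion fun l => stmtSymbols (tm.m l)) ∪
    Finset.univ.image (fun a : tm.Γ tm.k₀ => (⟨tm.k₀, a⟩ : Σ k, tm.Γ k)) ∪
    {⟨tm.k₁, eout.symm true⟩}
  have hD : ∀ l, stmtDepth (tm.m l) ≤ D := fun l =>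
    Finset.single_le_sum (f := fun l => stmtDepth (tm.m l)) (fun _ _ => Nat.zero_le _)
      (Finset.mem_univ l)
  let T : ℕ → ℕ := fun n => time.eval (n + h n)
  -- Initial height `n + h n`, growth by at most `D` in each of `T n` steps, and one more to make
  -- the bound strict.
  let H : ℕ → ℕ := fun n => n + h n + T n * D + 1
  have hT : PolyBound T := (PolyBound.eval time).comp (PolyBound.id.add hp)
  have hH : PolyBound H := ((PolyBound.id.add hp).add (hT.mul (.const D))).add (.const 1)
  refine mem_PPoly_of_nondeterministic hα (p := fun n => n + h n + (T n + 1) *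
    ((Fintype.card tm.Λ + 1 + (Fintype.card tm.σ + A.card * H n)) * HasCircuit.localCost
      (Fintype.card tm.Λ + 1 + (Fintype.card tm.σ + A.card * (3 * D + 1)))))
    ((PolyBound.id.add hp).add ((hT.add (.const 1)).mul (((PolyBound.const _).add
      ((PolyBound.const _).add ((PolyBound.const _).mul hH))).mul (.const _)))) fun n => ?_
  let enc : (Fin (n + h n) → Bool) → List (Bool ⊕ Bool) := fun z =>
    (Computability.encodingProd (Computability.encodingList Bool)
      (Computability.encodingList Bool)).encode
        (List.ofFn fun i : Fin n => z (i.castAdd _), List.ofFn fun i : Fin (h n) => z (i.natAdd n))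
  have hencl : ∀ z, (enc z).length = n + h n := fun z => by
    simp [enc, Computability.encodingProd, Computability.encodingList]
  refine ⟨h n, fun z => V (List.ofFn fun i : Fin n => z (i.castAdd _))
    (List.ofFn fun i : Fin (h n) => z (i.natAdd n)), ?_, fun x => ?_⟩
  · refine hasCircuit_cfg tm.m A (fun l => ?_) D hD
      (fun z => initList tm ((enc z).map ein.symm)) (T n) (H n)
      (fun z k => ?_) (fun z k a ha => ?_) (fun x y => rfl) (fun x y => rfl) (fun k i => ?_)
      tm.k₁ _ (eout.symm true) (by simp [A]) (fun z => ?_)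
    · exact ((Finset.subset_biUnion_of_mem (fun l => stmtSymbols (tm.m l)) (Finset.mem_univ l)).trans
        Finset.subset_union_left).trans Finset.subset_union_left
    · by_cases hk : k = tm.k₀
      · subst hk
        simp [initList, hencl, H]
      · simp [initList, hk, H]
    · by_cases hk : k = tm.k₀
      · subst hk
        simp [A]
      · simp [initList, hk] at ha
    · by_cases hk : k = tm.k₀
      · subst hk
        have : ∀ z, (initList tm ((enc z).map ein.symm)).stk tm.k₀ = List.ofFn
            fun i : Fin (n + h n) => ein.symm (if (i : ℕ) < n then .inl (z i) else .inr (z i)) :=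
          fun z => by
            simp only [initList, dite_true]
            exact map_encode_append ein.symm z
        by_cases hi : i < n + h n
        · refine ⟨{⟨i, hi⟩}, by simp, fun x y hxy => ?_⟩
          have hxy : x ⟨i, hi⟩ = y ⟨i, hi⟩ := hxy _ (by simp)
          rw [this, this, List.getElem?_ofFn, List.getElem?_ofFn]
          simp [hi, hxy]
        · refine ⟨∅, by simp, fun x y hxy => ?_⟩
          rw [this, this, List.getElem?_ofFn, List.getElem?_ofFn]
          simp [hi]
      · exact ⟨∅, by simp, fun x y _ => by simp [initList, hk]⟩
    · have ho := outputs (List.ofFn fun i : Fin n => z (i.castAdd _),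
        List.ofFn fun i : Fin (h n) => z (i.natAdd n))
      have hfin := nextCfg_iterate_le (T := T n) (M := tm.m) (ho.steps_le_m.trans
        (by simp only [T]; rw [← hencl z])) ho.evals_in_steps rfl
      have e1 : initList tm ((enc z).map ein.symm) = initList tm ((enc z).map ein.invFun) := rfl
      rw [e1, hfin]
      simp [haltList, Computability.encodeBool]
  · rw [hL]
    constructor
    · rintro ⟨u, hu, hV⟩
      have hu' : u.length = h n := by simpa using hu
      refine ⟨fun i => u[i], ?_⟩
      have : (List.ofFn fun i : Fin (h n) => u[i]) = u := by
        apply List.ext_getElem <;> simp [hu']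
      have hx : List.ofFn (fun i : Fin n => Fin.append x (fun i : Fin (h n) => u[i]) (i.castAdd _)) =
          List.ofFn x := by simp
      simp only [Fin.append_right, hx]
      rw [this]
      exact hV
    · rintro ⟨u, hu⟩
      exact ⟨List.ofFn u, by simp, by simpa using hu⟩

end NonuniformIS

namespace NonuniformIS

/-! ### Codes of formulas -/

/-- The number with the given binary digits, least significant first. -/
def ofDigits (d : List Bool) : ℕ := d.foldr Nat.bit 0

theorem ofDigits_bits (n : ℕ) : ofDigits n.bits = n := by
  induction n using Nat.binaryRec' with
  | zero => simp [ofDigits]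
  | bit b n h ih =>
    rw [Nat.bits_append_bit n b h]
    simpa [ofDigits] using congrArg (Nat.bit b) ih

/-- Self-delimiting code of a list of binary digits. -/
def encodeDigits (d : List Bool) : List Bool := d.flatMap (fun b => [true, b]) ++ [false]

theorem encodeLiteral_eq (l : Literal) : encodeLiteral l = l.2 :: encodeDigits l.1.bits := rfl

@[simp]
theorem encodeDigits_nil : encodeDigits [] = [false] := rfl

@[simp]
theorem encodeDigits_cons (b : Bool) (d : List Bool) :
    encodeDigits (b :: d) = true :: b :: encodeDigits d := rfl

@[simp]
theorem length_encodeDigits (d : List Bool) : (encodeDigits d).length = 2 * d.length + 1 := by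
  induction d with
  | nil => rfl
  | cons b d ih => simp [ih]; omega

/-- Injectivity is proved with arbitrary remainders: this prefix property passes from digits to
literals, clauses and formulas by concatenation. -/
theorem encodeDigits_append_inj {d d' r r' : List Bool}
    (h : encodeDigits d ++ r = encodeDigits d' ++ r') : d = d' ∧ r = r' := by
  induction d generalizing d' with
  | nil => cases d' <;> simp_all
  | cons b d ih =>
    cases d' with
    | nil => simp at h
    | cons b' d' =>
      simp only [encodeDigits_cons, List.cons_append, List.cons.injEq, true_and] at h
      obtain ⟨rfl, h⟩ := h
      obtain ⟨rfl, rfl⟩ := ih h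
      exact ⟨rfl, rfl⟩

theorem encodeLiteral_append_inj {l l' : Literal} {r r' : List Bool}
    (h : encodeLiteral l ++ r = encodeLiteral l' ++ r') : l = l' ∧ r = r' := by
  obtain ⟨v, s⟩ := l
  obtain ⟨v', s'⟩ := l'
  simp only [encodeLiteral_eq, List.cons_append, List.cons.injEq] at h
  obtain ⟨rfl, h⟩ := h
  obtain ⟨hb, rfl⟩ := encodeDigits_append_inj h
  rw [← ofDigits_bits v, hb, ofDigits_bits]
  exact ⟨rfl, rfl⟩

@[simp]
theorem encodeClause_nil : encodeClause [] = [false] := rfl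

@[simp]
theorem encodeClause_cons (l : Literal) (c : List Literal) :
    encodeClause (l :: c) = true :: (encodeLiteral l ++ encodeClause c) := by
  simp [encodeClause]

theorem encodeClause_append_inj {c c' : List Literal} {r r' : List Bool}
    (h : encodeClause c ++ r = encodeClause c' ++ r') : c = c' ∧ r = r' := by
  induction c generalizing c' with
  | nil => cases c' <;> simp_all
  | cons l c ih =>
    cases c' with
    | nil => simp at h
    | cons l' c' =>
      simp only [encodeClause_cons, List.cons_append, List.append_assoc, List.cons.injEq,
        true_and] at h
      obtain ⟨rfl, h'⟩ := encodeLiteral_append_inj h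
      obtain ⟨rfl, rfl⟩ := ih h'
      exact ⟨rfl, rfl⟩

theorem encodeClause_ne_nil (c : List Literal) : encodeClause c ≠ [] := by
  cases c <;> simp

@[simp]
theorem encodeCNF_nil : encodeCNF [] = [] := rfl

@[simp]
theorem encodeCNF_cons (c : List Literal) (φ : CNF) :
    encodeCNF (c :: φ) = encodeClause c ++ encodeCNF φ := rfl

theorem encodeCNF_injective : Function.Injective encodeCNF := by
  intro φ φ' h
  induction φ generalizing φ' with
  | nil =>
    cases φ' with
    | nil => rfl
    | cons c φ' => simp [encodeClause_ne_nil] at h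
  | cons c φ ih =>
    cases φ' with
    | nil => simp [encodeClause_ne_nil] at h
    | cons c' φ' =>
      obtain ⟨rfl, h'⟩ := encodeClause_append_inj h
      rw [ih h']

/-! ### Reduction of 3SATC to 3SAT -/

/-- The literal replacing `l` in a formula: variables with an odd number stand for the original
variables, and those with an even number occur only positively. -/
def guardLiteral (c : Bool) (l : Literal) : Literal := (Nat.bit c (l.1 + 1), l.2 || !c)

/-- The conjunction of the disjunctions `cl j` with `j < D` and `c j`, the others being replaced by
disjunctions of the same code length that can be satisfied independently. -/
def guardFormula (D : ℕ) (cl : ℕ → List Literal) (c : ℕ → Bool) : CNF :=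
  (List.range D).map fun j => (cl j).map (guardLiteral (c j))

/-- Present disjunctions use odd variables with their own signs. Absent ones use even variables, all
positive, and hold once those variables are true, provided they are nonempty. The shift `l.1 + 1`
keeps `Nat.bit c` from being applied to `0`, so the bit `c` always appears as a digit and the code
length does not depend on `c`. -/
theorem guardFormula_satisfiable_iff {D : ℕ} {cl : ℕ → List Literal} {c : ℕ → Bool}
    (hcl : ∀ j < D, cl j ≠ []) :
    (guardFormula D cl c).Satisfiable ↔
      ∃ σ : ℕ → Bool, ∀ j < D, c j = true → ∃ l ∈ cl j, Literal.Holds σ l := by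
  constructor
  · rintro ⟨τ, hτ⟩
    refine ⟨fun v => τ (Nat.bit true (v + 1)), fun j hj hc => ?_⟩
    obtain ⟨l, hl, h⟩ := hτ _ (List.mem_map.2 ⟨j, by simpa using hj, rfl⟩)
    obtain ⟨l, hl', rfl⟩ := List.mem_map.1 hl
    exact ⟨l, hl', by simpa [Literal.Holds, guardLiteral, hc] using h⟩
  · rintro ⟨σ, hσ⟩
    refine ⟨fun m => !m.bodd || σ (m.div2 - 1), fun d hd => ?_⟩
    obtain ⟨j, hj, rfl⟩ := List.mem_map.1 hd
    have hj : j < D := by simpa using hj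
    cases hc : c j with
    | true =>
      obtain ⟨l, hl, h⟩ := hσ j hj hc
      refine ⟨_, List.mem_map.2 ⟨l, hl, rfl⟩, ?_⟩
      have h : σ l.1 = l.2 := h
      simp only [Literal.Holds, guardLiteral, Nat.bodd_bit, Nat.div2_bit, Nat.add_sub_cancel, h]
      simp
    | false =>
      obtain ⟨l, hl⟩ := List.exists_mem_of_ne_nil _ (hcl j hj)
      refine ⟨_, List.mem_map.2 ⟨l, hl, rfl⟩, ?_⟩
      simp only [Literal.Holds, guardLiteral, Nat.bodd_bit, Nat.div2_bit]
      simp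

/-- The code of a formula `guardFormula D cl c`, as functions of `c`. -/
def guardTemplate (D : ℕ) (cl : ℕ → List Literal) : List ((ℕ → Bool) → Bool) :=
  (List.range D).flatMap fun j =>
    (cl j).flatMap (fun l => (fun _ => true) :: (fun c => l.2 || !(c j)) :: (fun _ => true) ::
      (fun c => c j) :: (encodeDigits (l.1 + 1).bits).map fun b _ => b) ++ [fun _ => false]

theorem guardTemplate_map (D : ℕ) (cl : ℕ → List Literal) (c : ℕ → Bool) :
    (guardTemplate D cl).map (fun w => w c) = encodeCNF (guardFormula D cl c) := by
  unfold guardTemplate guardFormula encodeCNF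
  rw [List.map_flatMap, List.flatMap_map]
  congr 1
  funext j
  unfold encodeClause
  rw [List.map_append, List.map_flatMap, List.flatMap_map]
  congr 2
  funext l
  simp [encodeLiteral_eq, guardLiteral, Function.comp_def]

/-- This locality makes the code a projection of the 3SATC input, so `subst_projection` applies. -/
theorem guardTemplate_local (D : ℕ) (cl : ℕ → List Literal) {w : (ℕ → Bool) → Bool}
    (hw : w ∈ guardTemplate D cl) : ∃ j < D, ∀ c c' : ℕ → Bool, c j = c' j → w c = w c' := by
  simp only [guardTemplate, List.mem_flatMap, List.mem_range, List.mem_append, List.mem_cons,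
    List.mem_map, List.not_mem_nil, or_false] at hw
  obtain ⟨j, hj, hw⟩ := hw
  refine ⟨j, hj, fun c c' h => ?_⟩
  rcases hw with ⟨l, -, rfl | rfl | rfl | rfl | ⟨b, -, rfl⟩⟩ | rfl <;> simp [h]

theorem length_guardTemplate_le (D k : ℕ) (cl : ℕ → List Literal)
    (h3 : ∀ j < D, (cl j).length ≤ 3) (hk : ∀ j < D, ∀ l ∈ cl j, l.1 < k) :
    (guardTemplate D cl).length ≤ D * (3 * (2 * k + 5) + 1) := by
  unfold guardTemplate
  rw [List.length_flatMap]
  refine (List.sum_le_card_nsmul _ (3 * (2 * k + 5) + 1) ?_).trans (by simp)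
  intro x hx
  obtain ⟨j, hj, rfl⟩ := List.mem_map.1 hx
  have hj : j < D := by simpa using hj
  rw [List.length_append, List.length_flatMap]
  simp only [List.length_singleton, add_le_add_iff_right]
  -- Per literal: its prefix bit, its sign, the two bits for the guard digit, and `2 * d + 1` bits
  -- for the `d ≤ k` digits of the shifted variable.
  refine (List.sum_le_card_nsmul _ (2 * k + 5) ?_).trans ?_
  · intro x hx
    obtain ⟨l, hl, rfl⟩ := List.mem_map.1 hx
    have h1 := hk j hj l hl
    have h2 : (l.1 + 1).size ≤ l.1 + 1 := Nat.size_le.2 Nat.lt_two_pow_self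
    simp [Nat.size_eq_bits_len]
    omega
  · rw [List.length_map, smul_eq_mul]
    exact Nat.mul_le_mul_right _ (h3 j hj)

/-- If 3SAT has polynomial-size circuits, then 3SATC has polynomial-length instruction
sequences. -/
theorem threeSATC_mem_PLIS (α : DisjNumbering) (h : threeSAT ∈ PPoly) : threeSATC α ∈ PLIS := by
  obtain ⟨q, hq, hC⟩ := mem_PPoly_iff.1 h
  obtain ⟨q, hqm, hqp, hle⟩ := hq.exists_monotone
  let N : ℕ → ℕ := fun n => n * (3 * (2 * n + 5) + 1)
  have hN : PolyBound N := PolyBound.id.mul (((PolyBound.const 3).mul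
    (((PolyBound.const 2).mul .id).add (.const 5))).add (.const 1))
  obtain ⟨r, hr, hler⟩ := (((PolyBound.const 4).mul ((PolyBound.id.add (hN.mul
    (.const (HasCircuit.localCost 1)))).add (hqp.comp hN))).add (.const 3)).exists_mem_poly
  refine ⟨r, hr, fun n => ?_⟩
  set k := numVars n with hk
  have hDn : numDisj k ≤ n := numDisj_numVars_le n
  have hkn : k ≤ n := numDisj_strictMono.le_apply.trans hDn
  let cl : ℕ → List Literal := fun j => (α.disj k j).toList
  have hmem : ∀ j < numDisj k, α.disj k j ∈ disjSets k := fun j hj => (α.bijOn k).mapsTo hj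
  have hcl : ∀ j < numDisj k, cl j ≠ [] := fun j hj => by
    have := (hmem j hj).2.1
    simp only [cl, ne_eq, Finset.toList_eq_nil]
    rintro h0
    simp [h0] at this
  have hcl3 : ∀ j < numDisj k, (cl j).length ≤ 3 := fun j hj => by
    simpa [cl] using (hmem j hj).2.2
  let c : (Fin n → Bool) → ℕ → Bool := fun b j => if hj : j < n then b ⟨j, hj⟩ else false
  let W := guardTemplate (numDisj k) cl
  -- All formulas for inputs of length `n` have codes of length `W.length`, so a single 3SAT circuit
  -- handles them.
  obtain ⟨f, hf, hfx⟩ := hC W.length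
  let π : (Fin n → Bool) → Fin W.length → Bool := fun b i => W[i] (c b)
  have hlen : W.length ≤ N n := by
    refine (length_guardTemplate_le _ k cl hcl3 fun j hj l hl =>
      (hmem j hj).1 l (by simpa [cl] using hl)).trans ?_
    simp only [N]
    gcongr
  have hpi := hf.subst_projection π fun i => by
    obtain ⟨j, hj, hw⟩ := guardTemplate_local _ _ (List.getElem_mem i.2)
    exact ⟨{⟨j, hj.trans_le hDn⟩}, by simp, fun x y hxy => hw _ _ (by
      simpa [c, hj.trans_le hDn] using hxy)⟩
  have heq : (fun b => f (π b)) = threeSATC α n := by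
    funext b
    rw [Bool.eq_iff_iff, hfx]
    have hW : List.ofFn (π b) = encodeCNF (guardFormula (numDisj k) cl (c b)) := by
      rw [← guardTemplate_map]
      apply List.ext_getElem <;> simp [π, W]
    rw [hW]
    simp only [threeSATC, decide_eq_true_iff]
    have h1 : encodeCNF (guardFormula (numDisj k) cl (c b)) ∈ threeSAT ↔
        (guardFormula (numDisj k) cl (c b)).Satisfiable := by
      constructor
      · rintro ⟨φ, -, hφ, he⟩
        rwa [← encodeCNF_injective he]
      · refine fun hs => ⟨_, fun d hd => ?_, hs, rfl⟩
        obtain ⟨j, hj, rfl⟩ := List.mem_map.1 hd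
        simpa using hcl3 j (by simpa using hj)
    rw [h1, guardFormula_satisfiable_iff hcl]
    refine exists_congr fun σ => ⟨fun h i hi hb => ?_, fun h j hj hc => ?_⟩
    · simpa [cl] using h i hi (by simpa [c] using hb)
    · have hjn := hj.trans_le hDn
      simpa [cl] using h ⟨j, hjn⟩ hj (by simpa [c, hjn] using hc)
  rw [heq] at hpi
  obtain ⟨X, hX, hcomp, hXlen⟩ := hpi.exists_computes
  refine ⟨X, hX, hcomp, hXlen.trans ((?_ : _ ≤ _).trans (hler n))⟩
  have h2 : q W.length ≤ q (N n) := hqm hlen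
  have h3 := hle W.length
  have h4 : W.length * HasCircuit.localCost 1 ≤ N n * HasCircuit.localCost 1 := by gcongr
  omega

end NonuniformIS

namespace NonuniformIS

/-! ### A finite-state parser for annotated formulas -/

/-- States of the parser: between clauses, in a clause with `c` literals read, before a sign, in the
digits of a literal, before a digit. The component `s` says whether the clause is already satisfied,
and `ok` whether the digits read so far do not end with `false`. -/
inductive ParseState where
  | start
  | clause (c : Fin 4) (s : Bool)
  | sign (c : Fin 3) (s : Bool)
  | digits (c : Fin 4) (s ok : Bool)
  | digit (c : Fin 4) (s : Bool)
  deriving DecidableEq, Fintype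

/-- Transitions of the parser on reading a bit `x` with mark `m`. The mark of a sign is the value of
the variable. The output consists of the value of the variable and the digits of each literal. -/
def ParseState.next (x m : Bool) : ParseState → Option (ParseState × Option (Bool ⊕ Bool))
  | .start => if x then some (.sign 0 false, none) else none
  | .clause c s =>
    if x then if h : (c : ℕ) < 3 then some (.sign ⟨c, h⟩ s, none) else none
    else if s then some (.start, none) else none
  | .sign c s => some (.digits c.succ (s || x == m) true, some (.inr m))
  | .digits c s ok =>
    if x then some (.digit c s, none) else if ok then some (.clause c s, none) else none
  | .digit c s => some (.digits c s x, some (.inl x))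

/-- The output of the parser. -/
def parse : ParseState → List (Bool × Bool) → Option (List (Bool ⊕ Bool))
  | p, [] => if p = .start then some [] else none
  | p, (x, m) :: z =>
    match p.next x m with
    | none => none
    | some (p', o) => (parse p' z).map (o.toList ++ ·)

/-- Digit lists without leading zeros. -/
def CanonicalDigits (d : List Bool) : Prop := d.getLast? ≠ some false

theorem CanonicalDigits.tail {b : Bool} {d : List Bool} (h : CanonicalDigits (b :: d)) :
    CanonicalDigits d ∧ (d = [] → b = true) := by
  cases d with
  | nil => cases b <;> simp_all [CanonicalDigits]
  | cons c d => simpa [CanonicalDigits] using h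

theorem CanonicalDigits.cons {b : Bool} {d : List Bool} (h : CanonicalDigits d)
    (hb : d = [] → b = true) : CanonicalDigits (b :: d) := by
  cases d with
  | nil => simp_all [CanonicalDigits]
  | cons c d => simpa [CanonicalDigits] using h

theorem CanonicalDigits.bits_ofDigits {d : List Bool} (h : CanonicalDigits d) :
    (ofDigits d).bits = d := by
  induction d with
  | nil => simp [ofDigits]
  | cons b d ih =>
    obtain ⟨hd, hb⟩ := h.tail
    have h0 : ofDigits (b :: d) = Nat.bit b (ofDigits d) := rfl
    rw [h0, Nat.bits_append_bit, ih hd]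
    -- If the remaining digits have value `0`, the induction hypothesis makes them the empty list,
    -- and canonicity then forces `b = true`.
    intro hz
    have := ih hd
    rw [hz, Nat.zero_bits] at this
    exact hb this.symm

theorem canonicalDigits_bits (n : ℕ) : CanonicalDigits n.bits := by
  induction n using Nat.binaryRec' with
  | zero => simp [CanonicalDigits]
  | bit b n h ih =>
    rw [Nat.bits_append_bit n b h]
    refine ih.cons fun hn => h ?_
    rw [← ofDigits_bits n, hn]
    rfl

/-- An occurrence of a literal: digits of the variable, sign, and value of the variable. -/
abbrev MarkedLiteral : Type := List Bool × Bool × Bool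

/-- Code of a clause given by literal occurrences. -/
def encodeMarked (c : List MarkedLiteral) : List Bool :=
  c.flatMap (fun l => true :: l.2.1 :: encodeDigits l.1) ++ [false]

/-- Output of the parser for a list of literal occurrences. -/
def markedOutput (c : List MarkedLiteral) : List (Bool ⊕ Bool) :=
  c.flatMap fun l => .inr l.2.2 :: l.1.map .inl

/-- Clauses with at most three literals of which one is true under the marked values. -/
def GoodClause (c : List MarkedLiteral) : Prop :=
  c.length ≤ 3 ∧ (∀ l ∈ c, CanonicalDigits l.1) ∧ ∃ l ∈ c, l.2.1 = l.2.2

/-- Words and outputs for accepted remainders of a formula between clauses. -/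
def AcceptedRest (xs : List Bool) (E : List (Bool ⊕ Bool)) : Prop :=
  ∃ r : List (List MarkedLiteral), xs = r.flatMap encodeMarked ∧ E = markedOutput r.flatten ∧
    ∀ c ∈ r, GoodClause c

/-- Words and outputs for accepted remainders of a formula within a clause. -/
def AcceptedClause (n : ℕ) (s : Bool) (xs : List Bool) (E : List (Bool ⊕ Bool)) : Prop :=
  ∃ (c : List MarkedLiteral) (xs' : List Bool) (E' : List (Bool ⊕ Bool)),
    xs = encodeMarked c ++ xs' ∧ E = markedOutput c ++ E' ∧ AcceptedRest xs' E' ∧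
    c.length + n ≤ 3 ∧ (∀ l ∈ c, CanonicalDigits l.1) ∧ (s = true ∨ ∃ l ∈ c, l.2.1 = l.2.2)

/-- Words and outputs accepted from a state of the parser. -/
def Accepted : ParseState → List Bool → List (Bool ⊕ Bool) → Prop
  | .start, xs, E => AcceptedRest xs E
  | .clause c s, xs, E => AcceptedClause c s xs E
  | .sign c s, xs, E => ∃ d g m xs' E', xs = g :: (encodeDigits d ++ xs') ∧
      E = .inr m :: (d.map .inl ++ E') ∧ CanonicalDigits d ∧
      AcceptedClause (c + 1) (s || g == m) xs' E'
  | .digits c s ok, xs, E => ∃ d xs' E', xs = encodeDigits d ++ xs' ∧ E = d.map .inl ++ E' ∧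
      CanonicalDigits d ∧ (d = [] → ok = true) ∧ AcceptedClause c s xs' E'
  | .digit c s, xs, E => ∃ b d xs' E', xs = b :: (encodeDigits d ++ xs') ∧
      E = .inl b :: (d.map .inl ++ E') ∧ CanonicalDigits d ∧ (d = [] → b = true) ∧
      AcceptedClause c s xs' E'

theorem AcceptedClause.cons {n : ℕ} {s : Bool} {xs' : List Bool} {E' : List (Bool ⊕ Bool)}
    {d : List Bool} {g m : Bool} (hd : CanonicalDigits d)
    (h : AcceptedClause (n + 1) (s || g == m) xs' E') :
    AcceptedClause n s (true :: g :: (encodeDigits d ++ xs')) (.inr m :: (d.map .inl ++ E')) := by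
  obtain ⟨c, ys, F, rfl, rfl, hr, hl, hc, hs⟩ := h
  refine ⟨(d, g, m) :: c, ys, F, by simp [encodeMarked], by simp [markedOutput], hr,
    by simp only [List.length_cons]; omega, List.forall_mem_cons.2 ⟨hd, hc⟩, ?_⟩
  rcases hs with hs | ⟨l, hl, h⟩
  · rw [Bool.or_eq_true, beq_iff_eq] at hs
    exact hs.imp id fun h => ⟨_, List.mem_cons_self, h⟩
  · exact .inr ⟨l, List.mem_cons_of_mem _ hl, h⟩

theorem AcceptedClause.acceptedRest {xs : List Bool} {E : List (Bool ⊕ Bool)}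
    (h : AcceptedClause 0 false xs E) : AcceptedRest xs E := by
  obtain ⟨c, _, _, rfl, rfl, ⟨r, rfl, rfl, hr⟩, hl, hc, hs⟩ := h
  refine ⟨c :: r, by simp, by simp [markedOutput], ?_⟩
  simpa using ⟨⟨hl, hc, by simpa using hs⟩, hr⟩

/-- `Accepted` describes what may follow in each state, which makes the induction over the word
possible. Requiring canonical digits ensures that accepted words are codes of formulas and not
merely of numerals with superfluous zeros. -/
theorem parse_sound {p : ParseState} {z : List (Bool × Bool)} {E : List (Bool ⊕ Bool)}
    (h : parse p z = some E) : Accepted p (z.map Prod.fst) E := by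
  induction z generalizing p E with
  | nil =>
    simp only [parse, Option.ite_none_right_eq_some, Option.some.injEq] at h
    obtain ⟨rfl, rfl⟩ := h
    exact ⟨[], rfl, rfl, by simp⟩
  | cons a z ih =>
    obtain ⟨x, m⟩ := a
    simp only [parse] at h
    cases hp : p.next x m with
    | none => simp [hp] at h
    | some q =>
      obtain ⟨q, o⟩ := q
      simp only [hp, Option.map_eq_some_iff] at h
      obtain ⟨E, hE, rfl⟩ := h
      have ih := ih hE
      rw [List.map_cons]
      generalize z.map Prod.fst = xs at ih ⊢
      cases p with
      | start =>
        simp only [ParseState.next, Option.ite_none_right_eq_some, Option.some.injEq,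
          Prod.mk.injEq] at hp
        obtain ⟨rfl, rfl, rfl⟩ := hp
        obtain ⟨d, g, m, xs', E', rfl, rfl, hd, hc⟩ := ih
        exact (AcceptedClause.cons hd (by simpa using hc)).acceptedRest
      | clause c s =>
        simp only [ParseState.next] at hp
        split_ifs at hp with h1 h2 h2
        · simp only [Option.some.injEq, Prod.mk.injEq] at hp
          obtain ⟨rfl, rfl⟩ := hp
          obtain ⟨d, g, m, xs', E', rfl, rfl, hd, hc⟩ := ih
          subst h1
          exact AcceptedClause.cons hd hc
        · simp only [Option.some.injEq, Prod.mk.injEq] at hp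
          obtain ⟨rfl, rfl⟩ := hp
          have hc := c.2
          simp only [Bool.not_eq_true] at h1
          subst h1
          exact ⟨[], _, _, rfl, rfl, ih, by simp; omega, by simp, .inl h2⟩
      | sign c s =>
        simp only [ParseState.next, Option.some.injEq, Prod.mk.injEq] at hp
        obtain ⟨rfl, rfl⟩ := hp
        obtain ⟨d, xs', E', rfl, rfl, hd, -, hc⟩ := ih
        exact ⟨d, x, m, xs', E', rfl, rfl, hd, hc⟩
      | digits c s ok =>
        simp only [ParseState.next] at hp
        split_ifs at hp with h1 h2
        · simp only [Option.some.injEq, Prod.mk.injEq] at hp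
          obtain ⟨rfl, rfl⟩ := hp
          obtain ⟨b, d, xs', E', rfl, rfl, hd, hb, hc⟩ := ih
          exact ⟨b :: d, xs', E', by simp [h1], by simp, hd.cons hb, by simp, hc⟩
        · simp only [Option.some.injEq, Prod.mk.injEq] at hp
          obtain ⟨rfl, rfl⟩ := hp
          simp only [Bool.not_eq_true] at h1
          exact ⟨[], xs, E, by simp [h1], by simp, by simp [CanonicalDigits], fun _ => h2, ih⟩
      | digit c s =>
        simp only [ParseState.next, Option.some.injEq, Prod.mk.injEq] at hp
        obtain ⟨rfl, rfl⟩ := hp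
        obtain ⟨d, xs', E', rfl, rfl, hd, hx, hc⟩ := ih
        exact ⟨x, d, xs', E', rfl, rfl, hd, hx, hc⟩

theorem parse_digits (c : Fin 4) (s ok : Bool) {d : List Bool} (hd : CanonicalDigits d)
    (hok : d = [] → ok = true) (z : List (Bool × Bool)) :
    parse (.digits c s ok) ((encodeDigits d).map (·, false) ++ z) =
      (parse (.clause c s) z).map (d.map .inl ++ ·) := by
  induction d generalizing ok with
  | nil => simp [parse, ParseState.next, hok]
  | cons b d ih =>
    obtain ⟨hd, hb⟩ := hd.tail
    simp [parse, ParseState.next, ih b hd hb, Function.comp_def]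

/-- The marked code of a clause under an assignment. -/
def markClause (σ : ℕ → Bool) (c : List Literal) : List (Bool × Bool) :=
  c.flatMap (fun l => (true, false) :: (l.2, σ l.1) :: (encodeDigits l.1.bits).map (·, false)) ++
    [(false, false)]

/-- The occurrence of a literal with the value of its variable under an assignment. -/
def markLiteral (σ : ℕ → Bool) (l : Literal) : MarkedLiteral := (l.1.bits, l.2, σ l.1)

theorem parse_markClause (σ : ℕ → Bool) (n : Fin 4) (s : Bool) (c : List Literal)
    (hn : c.length + n ≤ 3) (hs : s = true ∨ ∃ l ∈ c, Literal.Holds σ l)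
    (z : List (Bool × Bool)) :
    parse (.clause n s) (markClause σ c ++ z) =
      (parse .start z).map (markedOutput (c.map (markLiteral σ)) ++ ·) := by
  induction c generalizing n s with
  | nil =>
    have hs : s = true := by simpa using hs
    simp [markClause, parse, ParseState.next, hs, markedOutput]
  | cons l c ih =>
    have hn3 : (n : ℕ) < 3 := by simp only [List.length_cons] at hn; omega
    have h1 : markClause σ (l :: c) ++ z = (true, false) :: (l.2, σ l.1) ::
        ((encodeDigits l.1.bits).map (·, false) ++ (markClause σ c ++ z)) := by
      simp [markClause]
    rw [h1]
    simp only [parse, ParseState.next, if_true, dif_pos hn3]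
    rw [parse_digits _ _ _ (canonicalDigits_bits _) (fun _ => rfl), ih]
    · simp [Function.comp_def, markedOutput, markLiteral]
    · simp only [List.length_cons, Fin.val_succ] at hn ⊢
      omega
    · rcases hs with hs | ⟨l', hl', h⟩
      · simp [hs]
      · rcases List.mem_cons.1 hl' with rfl | hl'
        · left
          have : σ l'.1 = l'.2 := h
          simp [this]
        · exact .inr ⟨l', hl', h⟩

theorem parse_complete (σ : ℕ → Bool) (φ : CNF) (h3 : φ.Is3CNF)
    (hs : ∀ c ∈ φ, ∃ l ∈ c, Literal.Holds σ l) :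
    parse .start (φ.flatMap (markClause σ)) =
      some (markedOutput ((φ.flatten).map (markLiteral σ))) := by
  induction φ with
  | nil => simp [parse, markedOutput]
  | cons c φ ih =>
    -- The states `start` and `clause 0 false` differ only on reading the end of the word, and a
    -- satisfied clause is nonempty, so it begins with `true`.
    have h0 : ∀ z, parse .start (markClause σ c ++ z) = parse (.clause 0 false)
        (markClause σ c ++ z) := by
      obtain ⟨l, hl, -⟩ := hs c (by simp)
      intro z
      cases c with
      | nil => simp at hl
      | cons l c => simp [markClause, parse, ParseState.next]
    rw [List.flatMap_cons, h0, parse_markClause, ih]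
    · simp [markedOutput]
    · exact fun d hd => h3 d (by simp [hd])
    · exact fun d hd => hs d (by simp [hd])
    · simpa using h3 c (by simp)
    · exact .inr (hs c (by simp))

theorem map_fst_markClause (σ : ℕ → Bool) (φ : CNF) :
    (φ.flatMap (markClause σ)).map Prod.fst = encodeCNF φ := by
  unfold encodeCNF
  rw [List.map_flatMap]
  congr 1
  funext c
  simp [markClause, encodeClause, List.map_flatMap, encodeLiteral_eq, Function.comp_def]

/-! ### Verification of annotated formulas -/

/-- Blocks consisting of the reversed digits and the value of a variable, as stack content. -/
def blockSymbols (B : List (List Bool × Bool)) : List (Bool ⊕ Bool) :=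
  B.flatMap fun b => b.1.map .inl ++ [.inr b.2]

@[simp]
theorem blockSymbols_cons (b : List Bool × Bool) (B : List (List Bool × Bool)) :
    blockSymbols (b :: B) = b.1.map .inl ++ .inr b.2 :: blockSymbols B := by
  simp [blockSymbols]

theorem map_inl_append_inj {d d' : List Bool} {m m' : Bool} {r r' : List (Bool ⊕ Bool)}
    (h : d.map Sum.inl ++ .inr m :: r = d'.map Sum.inl ++ .inr m' :: r') :
    d = d' ∧ m = m' ∧ r = r' := by
  induction d generalizing d' with
  | nil => cases d' <;> simp_all
  | cons b d ih =>
    cases d' with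
    | nil => simp at h
    | cons b' d' =>
      simp only [List.map_cons, List.cons_append, List.cons.injEq, Sum.inl.injEq] at h
      obtain ⟨rfl, h⟩ := h
      obtain ⟨rfl, rfl, rfl⟩ := ih h
      exact ⟨rfl, rfl, rfl⟩

theorem blockSymbols_injective : Function.Injective blockSymbols := by
  intro B B' h
  induction B generalizing B' with
  | nil =>
    cases B' with
    | nil => rfl
    | cons b B' => simp [blockSymbols] at h
  | cons b B ih =>
    cases B' with
    | nil => simp [blockSymbols] at h
    | cons b' B' =>
      simp only [blockSymbols_cons] at h
      obtain ⟨h1, h2, h3⟩ := map_inl_append_inj h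
      rw [ih h3, Prod.ext h1 h2]

/-- The blocks of a list of literal occurrences. -/
def markedBlocks (c : List MarkedLiteral) : List (List Bool × Bool) :=
  (c.map fun l => (l.1.reverse, l.2.2)).reverse

/-- The parser pushes its output on a stack, where it appears reversed: then each value follows the
digits of its variable and serves as end marker of the block. -/
theorem reverse_markedOutput (c : List MarkedLiteral) :
    (markedOutput c).reverse = blockSymbols (markedBlocks c) := by
  induction c with
  | nil => rfl
  | cons l c ih =>
    have h1 : markedOutput (l :: c) = .inr l.2.2 :: (l.1.map .inl ++ markedOutput c) := by
      simp [markedOutput]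
    rw [h1, List.reverse_cons, List.reverse_append, ih]
    simp [markedBlocks, blockSymbols]

/-- Equal variables have equal values. -/
def ConsistentBlocks (B : List (List Bool × Bool)) : Prop :=
  B.Pairwise fun p q => q.1 = p.1 → q.2 = p.2

open Classical in
/-- The verifier for 3SAT: the certificate lists the values of the variables at the positions of the
signs of literals, in reverse order. -/
noncomputable def verify (x u : List Bool) : Bool :=
  decide (∃ B, parse .start (x.reverse.zip u).reverse = some (blockSymbols B).reverse ∧
    ConsistentBlocks B)

theorem parse_eq_blocks {z : List (Bool × Bool)} {E : List (Bool ⊕ Bool)}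
    (h : parse .start z = some E) : ∃ B, E = (blockSymbols B).reverse := by
  obtain ⟨r, -, rfl, -⟩ := parse_sound h
  exact ⟨_, by rw [← reverse_markedOutput, List.reverse_reverse]⟩

theorem exists_parse_of_mem_threeSAT {x : List Bool} (hx : x ∈ threeSAT) :
    ∃ z : List (Bool × Bool), z.map Prod.fst = x ∧
      ∃ B, parse .start z = some (blockSymbols B).reverse ∧ ConsistentBlocks B := by
  obtain ⟨φ, h3, ⟨σ, hσ⟩, rfl⟩ := hx
  refine ⟨φ.flatMap (markClause σ), map_fst_markClause σ φ,
    markedBlocks (φ.flatten.map (markLiteral σ)), ?_, ?_⟩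
  · rw [parse_complete σ φ h3 hσ, ← reverse_markedOutput, List.reverse_reverse]
  · refine List.pairwise_of_forall_mem_list fun p hp q hq h => ?_
    simp only [markedBlocks, markLiteral, List.map_map, List.mem_reverse, List.mem_map,
      Function.comp_apply] at hp hq
    obtain ⟨l, -, rfl⟩ := hp
    obtain ⟨l', -, rfl⟩ := hq
    simp only [List.reverse_inj] at h ⊢
    rw [← ofDigits_bits l.1, ← ofDigits_bits l'.1, h]

/-- A variable is made true iff some block gives it the value true. By consistency this agrees with
the values marked in all blocks, and under those values each clause has a true literal. -/
theorem mem_threeSAT_of_parse {z : List (Bool × Bool)} {B : List (List Bool × Bool)}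
    (h : parse .start z = some (blockSymbols B).reverse) (hB : ConsistentBlocks B) :
    z.map Prod.fst ∈ threeSAT := by
  classical
  obtain ⟨r, hx, hE, hr⟩ := parse_sound h
  have hBr : B = markedBlocks r.flatten :=
    blockSymbols_injective (by rw [← reverse_markedOutput, ← hE, List.reverse_reverse])
  -- Consistency compares blocks in list order only; the relation is symmetric and reflexive, so it
  -- holds for all pairs.
  have hcons : ∀ p ∈ B, ∀ q ∈ B, q.1 = p.1 → q.2 = p.2 := fun p hp q hq =>
    have : Std.Symm fun p q : List Bool × Bool => q.1 = p.1 → q.2 = p.2 :=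
      ⟨fun p q h h' => (h h'.symm).symm⟩
    List.Pairwise.forall_of_forall (fun _ _ _ => rfl) hB hp hq
  let lit : MarkedLiteral → Literal := fun l => (ofDigits l.1, l.2.1)
  refine ⟨r.map (List.map lit), ?_, ⟨fun v => decide ((v.bits.reverse, true) ∈ B), ?_⟩, ?_⟩
  · intro c hc
    obtain ⟨c, hc', rfl⟩ := List.mem_map.1 hc
    simpa using (hr c hc').1
  · intro c hc
    obtain ⟨c, hc', rfl⟩ := List.mem_map.1 hc
    obtain ⟨-, hcan, l, hl, hlm⟩ := hr c hc'
    refine ⟨lit l, List.mem_map_of_mem hl, ?_⟩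
    have hmem : (l.1.reverse, l.2.2) ∈ B := by
      rw [hBr]
      simp only [markedBlocks, List.mem_reverse, List.mem_map]
      exact ⟨l, List.mem_flatten.2 ⟨c, hc', hl⟩, rfl⟩
    simp only [Literal.Holds, lit, (hcan l hl).bits_ofDigits, hlm]
    cases hm : l.2.2 with
    | true => simpa [hm] using hmem
    | false =>
      simp only [decide_eq_false_iff_not]
      intro h
      have := hcons _ hmem _ h rfl
      simp [hm] at this
  · rw [hx]
    unfold encodeCNF
    rw [List.flatMap_map]
    refine List.flatMap_congr fun c hc => ?_
    unfold encodeClause encodeMarked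
    rw [List.flatMap_map]
    congr 1
    refine List.flatMap_congr fun l hl => ?_
    simp [encodeLiteral_eq, lit, ((hr c hc).2.1 l hl).bits_ofDigits]

/-- The certificate is aligned with the word from its end because the machine, having moved the word
to a stack, meets its last bit first. -/
theorem mem_threeSAT_iff_verify (x : List Bool) :
    x ∈ threeSAT ↔ ∃ u : List Bool, u.length = x.length ∧ verify x u = true := by
  simp only [verify, decide_eq_true_iff]
  constructor
  · intro hx
    obtain ⟨z, rfl, hB⟩ := exists_parse_of_mem_threeSAT hx
    refine ⟨(z.map Prod.snd).reverse, by simp, ?_⟩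
    have : ((z.map Prod.fst).reverse.zip (z.map Prod.snd).reverse).reverse = z := by
      rw [← List.map_reverse, ← List.map_reverse, List.zip_map']
      simp
    rwa [this]
  · rintro ⟨u, hu, B, h, hB⟩
    have := mem_threeSAT_of_parse h hB
    rwa [List.map_reverse, List.map_fst_zip (by simp [hu]), List.reverse_reverse] at this

end NonuniformIS

namespace NonuniformIS

/-! ### A stack machine deciding the verifier -/

namespace Verifier

/-- Working stacks. -/
inductive Reg where
  | inp | arg | zip | word | cur | ref | done
  deriving DecidableEq

instance : Fintype Reg :=
  ⟨{.inp, .arg, .zip, .word, .cur, .ref, .done}, fun r => by cases r <;> simp⟩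

/-- Contents of the working stacks. -/
structure Regs where
  inp : List (Bool ⊕ Bool)
  arg : List (Bool ⊕ Bool)
  zip : List (Bool ⊕ Bool)
  word : List (Bool ⊕ Bool)
  cur : List (Bool ⊕ Bool)
  ref : List (Bool ⊕ Bool)
  done : List (Bool ⊕ Bool)

/-- The content of a stack. -/
def Regs.get (S : Regs) : Reg → List (Bool ⊕ Bool)
  | .inp => S.inp
  | .arg => S.arg
  | .zip => S.zip
  | .word => S.word
  | .cur => S.cur
  | .ref => S.ref
  | .done => S.done

/-- Replacement of the content of a stack. -/
def Regs.set (S : Regs) (r : Reg) (L : List (Bool ⊕ Bool)) : Regs :=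
  match r with
  | .inp => { S with inp := L }
  | .arg => { S with arg := L }
  | .zip => { S with zip := L }
  | .word => { S with word := L }
  | .cur => { S with cur := L }
  | .ref => { S with ref := L }
  | .done => { S with done := L }

/-- The total height of the stacks. -/
def Regs.size (S : Regs) : ℕ :=
  S.inp.length + S.arg.length + S.zip.length + S.word.length + S.cur.length + S.ref.length +
    S.done.length

theorem Regs.size_set (S : Regs) (r : Reg) (L : List (Bool ⊕ Bool)) :
    (S.set r L).size + (S.get r).length = S.size + L.length := by
  cases r <;> simp only [Regs.set, Regs.get, Regs.size] <;> omega

theorem Regs.get_set_self (S : Regs) (r : Reg) (L : List (Bool ⊕ Bool)) :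
    (S.set r L).get r = L := by
  cases r <;> rfl

theorem Regs.set_set (S : Regs) (r : Reg) (L L' : List (Bool ⊕ Bool)) :
    (S.set r L).set r L' = S.set r L' := by
  cases r <;> rfl

/-- Labels: `read` and `pair` combine word and certificate, `parse` runs the parser, `take` and
`restore` fetch a block, `digit`, `compare` and `rest` compare it with the other blocks, `back`
and `clear` prepare the next round, `clean` empties the stacks. -/
inductive Label where
  | read | pair | parse | take | restore | digit | compare | rest | back | clear
  | clean (r : Reg)
  | finish
  deriving DecidableEq, Fintype

/-- Local variables: parser state, value of the fetched block, symbol read last, result of the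
comparison of digits, answer. -/
structure Vars where
  state : ParseState
  value : Bool
  bit : Bool
  same : Bool
  answer : Bool
  deriving Fintype

/-- The stack popped at a label. -/
def source : Label → Reg
  | .read => .inp
  | .pair => .arg
  | .parse => .zip
  | .take => .word
  | .restore => .cur
  | .digit => .word
  | .compare => .ref
  | .rest => .ref
  | .back => .done
  | .clear => .ref
  | .clean r => r
  | .finish => .inp

/-- The stack pushed at a label. -/
def target : Label → Reg
  | .read => .arg
  | .pair => .zip
  | .parse => .word
  | .take => .cur
  | .restore => .ref
  | .digit => .done
  | .compare => .cur
  | .rest => .cur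
  | .back => .word
  | .clear => .ref
  | .clean r => r
  | .finish => .inp

/-- A bit with a mark as a stack symbol. -/
def pairSymbol (a : Bool × Bool) : Bool ⊕ Bool := if a.2 then .inr a.1 else .inl a.1

/-- The label after emptying a stack. -/
def cleanNext : Reg → Label
  | .inp => .clean .arg
  | .arg => .clean .zip
  | .zip => .clean .word
  | .word => .clean .cur
  | .cur => .clean .ref
  | .ref => .clean .done
  | .done => .finish

/-- Transitions: next label, new values of the variables, symbol to be pushed. -/
def trans : Label → Vars → Option (Bool ⊕ Bool) → Label × Vars × Option (Bool ⊕ Bool)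
  | .read, v, some (.inl b) => (.read, v, some (.inl b))
  | .read, v, some (.inr m) => (.pair, { v with bit := m }, none)
  | .read, v, none => (.parse, v, none)
  | .pair, v, some s => (.read, v, some (pairSymbol (s.elim id id, v.bit)))
  | .pair, v, none => (.read, v, none)
  | .parse, v, some s =>
    match v.state.next (s.elim id id) s.isRight with
    | none => (.clean .inp, { v with answer := false }, none)
    | some (p, o) => (.parse, { v with state := p }, o)
  | .parse, v, none =>
    (bif decide (v.state = .start) then .take else .clean .inp, { v with answer := false }, none)
  | .take, v, some (.inl b) => (.take, v, some (.inl b))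
  | .take, v, some (.inr m) => (.restore, { v with value := m }, none)
  | .take, v, none => (.clean .inp, { v with answer := true }, none)
  | .restore, v, some s => (.restore, v, some s)
  | .restore, v, none => (.digit, { v with same := true }, none)
  | .digit, v, some (.inl b) => (.compare, { v with bit := b }, some (.inl b))
  | .digit, v, some (.inr m) => (.rest, { v with bit := m }, some (.inr m))
  | .digit, v, none => (.back, v, none)
  | .compare, v, some s => (.digit, { v with same := v.same && s == .inl v.bit }, some s)
  | .compare, v, none => (.digit, { v with same := false }, none)
  | .rest, v, some s => (.rest, { v with same := false }, some s)
  | .rest, v, none =>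
    (bif v.same && v.value != v.bit then .clean .inp else .restore, { v with answer := false },
      none)
  | .back, v, some s => (.back, v, some s)
  | .back, v, none => (.clear, v, none)
  | .clear, v, some _ => (.clear, v, none)
  | .clear, v, none => (.take, v, none)
  | .clean r, v, some _ => (.clean r, v, none)
  | .clean r, v, none => (cleanNext r, v, none)
  | .finish, v, _ => (.finish, v, none)

theorem trans_none (l : Label) (v : Vars) : (trans l v none).2.2 = none := by
  cases l <;> rfl

/-- Configurations without the output stack. -/
abbrev Conf : Type := Label × Vars × Regs

/-- The stacks after popping `r` and pushing at most one symbol on `r'`. -/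
def Regs.move (S : Regs) (r r' : Reg) (o : Option (Bool ⊕ Bool)) : Regs :=
  match o with
  | none => S.set r (S.get r).tail
  | some s => (S.set r (S.get r).tail).set r' (s :: (S.set r (S.get r).tail).get r')

/-- One step. -/
def step : Conf → Conf
  | (.finish, v, S) => (.finish, v, S)
  | (l, v, S) =>
    let t := trans l v (S.get (source l)).head?
    (t.1, t.2.1, S.move (source l) (target l) t.2.2)

/-- Reachability within `t` steps. -/
def Reach (t : ℕ) (c c' : Conf) : Prop := ∃ s ≤ t, step^[s] c = c'

theorem Reach.refl (t : ℕ) (c : Conf) : Reach t c c := ⟨0, Nat.zero_le t, rfl⟩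

theorem Reach.mono {t t' : ℕ} {c c' : Conf} (h : Reach t c c') (ht : t ≤ t') : Reach t' c c' :=
  h.imp fun _ hs => ⟨hs.1.trans ht, hs.2⟩

theorem Reach.trans {t t' : ℕ} {c c' c'' : Conf} (h : Reach t c c') (h' : Reach t' c' c'') :
    Reach (t + t') c c'' := by
  obtain ⟨s, hs, rfl⟩ := h
  obtain ⟨s', hs', rfl⟩ := h'
  exact ⟨s' + s, by omega, by rw [Function.iterate_add_apply]⟩

theorem Reach.head {t : ℕ} {c c₁ c' : Conf} (h : Reach t c₁ c') (hc : step c = c₁ := by rfl) :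
    Reach (t + 1) c c' := by
  obtain ⟨s, hs, rfl⟩ := h
  exact ⟨s + 1, by omega, by rw [Function.iterate_succ_apply, hc]⟩

/-- At most one symbol is pushed, and only after one was popped, as nothing is pushed when the
source stack is empty. This bounds the list of blocks and the time for cleaning up by the input
length. -/
theorem size_step_le (c : Conf) : (step c).2.2.size ≤ c.2.2.size := by
  obtain ⟨l, v, S⟩ := c
  by_cases hl : l = .finish
  · subst hl
    rfl
  have hstep : (step (l, v, S)).2.2 = S.move (source l) (target l)
      (trans l v (S.get (source l)).head?).2.2 := by
    cases l <;> first | rfl | exact absurd rfl hl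
  rw [hstep]
  have h1 := S.size_set (source l) (S.get (source l)).tail
  cases hS : S.get (source l) with
  | nil =>
    rw [hS] at h1
    simp only [List.head?_nil, trans_none, Regs.move, hS, List.tail_nil] at h1 ⊢
    simpa using h1.le
  | cons s L =>
    rw [hS] at h1
    simp only [List.tail_cons, List.length_cons] at h1
    unfold Regs.move
    rw [hS]
    cases (Verifier.trans l v (s :: L).head?).2.2 with
    | none =>
      simp only [List.tail_cons]
      omega
    | some s' =>
      have h2 := (S.set (source l) L).size_set (target l)
        (s' :: (S.set (source l) L).get (target l))
      simp only [List.tail_cons, List.length_cons] at h2 ⊢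
      omega

theorem Reach.size_le {t : ℕ} {c c' : Conf} (h : Reach t c c') : c'.2.2.size ≤ c.2.2.size := by
  obtain ⟨s, -, rfl⟩ := h
  induction s with
  | zero => exact le_rfl
  | succ s ih =>
    rw [Function.iterate_succ_apply']
    exact (size_step_le _).trans ih

theorem reach_clean_one (r : Reg) (v : Vars) (S : Regs) :
    Reach ((S.get r).length + 1) (.clean r, v, S) (cleanNext r, v, S.set r []) := by
  have hstep : ∀ S : Regs, step (.clean r, v, S) =
      ((trans (.clean r) v (S.get r).head?).1, (trans (.clean r) v (S.get r).head?).2.1,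
        S.move r r (trans (.clean r) v (S.get r).head?).2.2) := fun _ => rfl
  generalize hL : S.get r = L
  induction L generalizing S with
  | nil =>
    have : S.move r r none = S.set r [] := by simp [Regs.move, hL]
    refine Reach.head (Reach.refl _ _) ?_
    simp only [hstep, hL, List.head?_nil, Verifier.trans, this]
  | cons s L ih =>
    have : S.move r r none = S.set r L := by simp [Regs.move, hL]
    have h := ih (S.set r L) (Regs.get_set_self _ _ _)
    rw [Regs.set_set] at h
    refine Reach.head h ?_
    simp only [hstep, hL, List.head?_cons, Verifier.trans, this]

/-- Empty stacks. -/
def Regs.empty : Regs := ⟨[], [], [], [], [], [], []⟩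

theorem reach_clean (v : Vars) (S : Regs) :
    Reach (S.size + 7) (.clean .inp, v, S) (.finish, v, .empty) := by
  have h := (((((reach_clean_one .inp v S).trans (reach_clean_one .arg v _)).trans
    (reach_clean_one .zip v _)).trans (reach_clean_one .word v _)).trans
    (reach_clean_one .cur v _)).trans (reach_clean_one .ref v _)
  refine (h.trans (reach_clean_one .done v _)).mono ?_
  simp only [Regs.get, Regs.set, Regs.size]
  omega

/-! #### Combining word and certificate, parsing -/

theorem reach_read_word (d : List Bool) (r a z w e f y : List (Bool ⊕ Bool)) (v : Vars) :
    Reach d.length (.read, v, ⟨d.map .inl ++ r, a, z, w, e, f, y⟩)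
      (.read, v, ⟨r, d.reverse.map .inl ++ a, z, w, e, f, y⟩) := by
  induction d generalizing a with
  | nil => exact Reach.refl _ _
  | cons b d ih =>
    have h := ih (.inl b :: a)
    simp only [List.map_cons, List.length_cons, List.reverse_cons, List.append_assoc,
      List.cons_append, List.nil_append, List.map_append, List.map_nil]
    exact h.head

/-- Each certificate bit is paired with the top of the reversed word; pushing the pairs restores the
original order for the parser. A certificate that is too long pops an empty stack without effect,
just as `zip` truncates. -/
theorem reach_read_certificate (u a : List Bool) (z w e f y : List (Bool ⊕ Bool)) (v : Vars) :
    ∃ b a', Reach (2 * u.length + 1) (.read, v, ⟨u.map .inr, a.map .inl, z, w, e, f, y⟩)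
      (.parse, { v with bit := b },
        ⟨[], a', ((a.zip u).reverse).map pairSymbol ++ z, w, e, f, y⟩) := by
  induction u generalizing a z v with
  | nil =>
    refine ⟨v.bit, a.map .inl, ?_⟩
    simp only [List.zip_nil_right, List.reverse_nil, List.map_nil, List.nil_append]
    exact (Reach.refl 0 _).head
  | cons m u ih =>
    cases a with
    | nil =>
      obtain ⟨b, a', h⟩ := ih [] z { v with bit := m }
      exact ⟨b, a', Reach.head (Reach.head (c := (.pair, { v with bit := m },
        ⟨u.map .inr, [], z, w, e, f, y⟩)) h)⟩
    | cons x a =>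
      obtain ⟨b, a', h⟩ := ih a (pairSymbol (x, m) :: z) { v with bit := m }
      refine ⟨b, a', ?_⟩
      simp only [List.zip_cons_cons, List.map_cons, List.reverse_cons, List.map_append,
        List.map_nil, List.append_assoc, List.cons_append, List.nil_append]
      exact Reach.head (Reach.head (c := (.pair, { v with bit := m },
        ⟨u.map .inr, .inl x :: a.map .inl, z, w, e, f, y⟩)) h)

theorem pairSymbol_elim (a : Bool × Bool) :
    (pairSymbol a).elim id id = a.1 ∧ (pairSymbol a).isRight = a.2 := by
  obtain ⟨x, m⟩ := a
  cases m <;> simp [pairSymbol]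

theorem step_parse_nil (v : Vars) (i a w e f y : List (Bool ⊕ Bool)) :
    step (.parse, v, ⟨i, a, [], w, e, f, y⟩) =
      (if v.state = .start then .take else .clean .inp, { v with answer := false },
        ⟨i, a, [], w, e, f, y⟩) := by
  have h : step (.parse, v, ⟨i, a, [], w, e, f, y⟩) =
      (bif decide (v.state = .start) then .take else .clean .inp, { v with answer := false },
        ⟨i, a, [], w, e, f, y⟩) := rfl
  rw [h, Bool.cond_decide]

theorem step_parse_cons (v : Vars) (i a w e f y : List (Bool ⊕ Bool)) (c : Bool × Bool)
    (z : List (Bool ⊕ Bool)) :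
    step (.parse, v, ⟨i, a, pairSymbol c :: z, w, e, f, y⟩) =
      match v.state.next c.1 c.2 with
      | none => (.clean .inp, { v with answer := false }, ⟨i, a, z, w, e, f, y⟩)
      | some (p, o) => (.parse, { v with state := p }, ⟨i, a, z, o.toList ++ w, e, f, y⟩) := by
  have h : step (.parse, v, ⟨i, a, pairSymbol c :: z, w, e, f, y⟩) =
      (let t := match v.state.next ((pairSymbol c).elim id id) (pairSymbol c).isRight with
        | none => ((.clean .inp, { v with answer := false }, none) :
          Label × Vars × Option (Bool ⊕ Bool))
        | some (p, o) => (.parse, { v with state := p }, o)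
      (t.1, t.2.1, Regs.move ⟨i, a, pairSymbol c :: z, w, e, f, y⟩ .zip .word t.2.2)) := rfl
  rw [h, (pairSymbol_elim c).1, (pairSymbol_elim c).2]
  cases v.state.next c.1 c.2 with
  | none => rfl
  | some q =>
    obtain ⟨p, o⟩ := q
    cases o <;> rfl

theorem reach_parse_some {z : List (Bool × Bool)} {v : Vars} {E : List (Bool ⊕ Bool)}
    (i a w e f y : List (Bool ⊕ Bool)) (h : parse v.state z = some E) :
    ∃ v', Reach (z.length + 1) (.parse, v, ⟨i, a, z.map pairSymbol, w, e, f, y⟩)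
      (.take, v', ⟨i, a, [], E.reverse ++ w, e, f, y⟩) := by
  induction z generalizing v w E with
  | nil =>
    simp only [parse, Option.ite_none_right_eq_some, Option.some.injEq] at h
    obtain ⟨hv, rfl⟩ := h
    refine ⟨{ v with answer := false }, Reach.head (Reach.refl _ _) ?_⟩
    rw [List.map_nil, step_parse_nil, if_pos hv]
    rfl
  | cons c z ih =>
    obtain ⟨x, m⟩ := c
    simp only [parse] at h
    cases hp : v.state.next x m with
    | none => simp [hp] at h
    | some q =>
      obtain ⟨p, o⟩ := q
      simp only [hp, Option.map_eq_some_iff] at h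
      obtain ⟨E, hE, rfl⟩ := h
      obtain ⟨v', hv'⟩ := ih (v := { v with state := p }) (o.toList ++ w) hE
      -- At most one symbol is emitted per transition, so reversal is trivial.
      have ho : o.toList.reverse = o.toList := by cases o <;> rfl
      rw [List.reverse_append, ho, List.append_assoc]
      refine ⟨v', Reach.head hv' ?_⟩
      rw [List.map_cons, step_parse_cons]
      simp only [hp]

theorem reach_parse_none {z : List (Bool × Bool)} {v : Vars}
    (i a w e f y : List (Bool ⊕ Bool)) (h : parse v.state z = none) :
    ∃ v' S, v'.answer = false ∧ Reach (z.length + 1)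
      (.parse, v, ⟨i, a, z.map pairSymbol, w, e, f, y⟩) (.clean .inp, v', S) := by
  induction z generalizing v w with
  | nil =>
    simp only [parse, ite_eq_right_iff, reduceCtorEq, imp_false] at h
    refine ⟨{ v with answer := false }, ⟨i, a, [], w, e, f, y⟩, rfl,
      Reach.head (Reach.refl _ _) ?_⟩
    rw [List.map_nil, step_parse_nil, if_neg h]
  | cons c z ih =>
    obtain ⟨x, m⟩ := c
    simp only [parse] at h
    cases hp : v.state.next x m with
    | none =>
      refine ⟨{ v with answer := false }, ⟨i, a, z.map pairSymbol, w, e, f, y⟩, rfl,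
        Reach.head (Reach.refl _ _) ?_⟩
      rw [List.map_cons, step_parse_cons]
      simp only [hp]
    | some q =>
      obtain ⟨p, o⟩ := q
      simp only [hp, Option.map_eq_none_iff] at h
      obtain ⟨v', S, hv', hr⟩ := ih (v := { v with state := p }) (o.toList ++ w) h
      refine ⟨v', S, hv', Reach.head hr ?_⟩
      rw [List.map_cons, step_parse_cons]
      simp only [hp]

/-! #### Comparing blocks -/

theorem reach_take (d : List Bool) (m : Bool) (i a z w e f y : List (Bool ⊕ Bool)) (v : Vars) :
    Reach (d.length + 1) (.take, v, ⟨i, a, z, d.map .inl ++ .inr m :: w, e, f, y⟩)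
      (.restore, { v with value := m }, ⟨i, a, z, w, d.reverse.map .inl ++ e, f, y⟩) := by
  induction d generalizing e with
  | nil => exact (Reach.refl 0 _).head
  | cons b d ih =>
    have h := ih (.inl b :: e)
    simp only [List.map_cons, List.length_cons, List.reverse_cons, List.append_assoc,
      List.cons_append, List.nil_append, List.map_append, List.map_nil]
    exact h.head

theorem reach_restore (i a z w e f y : List (Bool ⊕ Bool)) (v : Vars) :
    Reach (e.length + 1) (.restore, v, ⟨i, a, z, w, e, f, y⟩)
      (.digit, { v with same := true }, ⟨i, a, z, w, [], e.reverse ++ f, y⟩) := by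
  induction e generalizing f with
  | nil => exact (Reach.refl 0 _).head
  | cons s e ih =>
    have h := ih (s :: f)
    simp only [List.length_cons, List.reverse_cons, List.append_assoc, List.cons_append,
      List.nil_append]
    exact h.head

/-- Symbols left over in the reference block mean that the other block had fewer digits. -/
theorem reach_rest (i a z w e f y : List (Bool ⊕ Bool)) (v : Vars) :
    Reach f.length (.rest, v, ⟨i, a, z, w, e, f, y⟩)
      (.rest, { v with same := v.same && decide (f = []) },
        ⟨i, a, z, w, f.reverse ++ e, [], y⟩) := by
  induction f generalizing e v with
  | nil => simpa using Reach.refl 0 _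
  | cons s f ih =>
    have h := ih (s :: e) { v with same := false }
    simp only [List.length_cons, List.reverse_cons, List.append_assoc, List.cons_append,
      List.nil_append, reduceCtorEq, decide_false, Bool.and_false, Bool.false_and] at h ⊢
    exact h.head

/-- Comparison loses nothing: the block goes to `done` and the reference digits to `cur`, both
reversed, to be moved back later. Every digit of the block costs two steps. -/
theorem reach_compare (d f : List Bool) (m : Bool) (i a z w e y : List (Bool ⊕ Bool)) (v : Vars) :
    Reach (2 * d.length + f.length + 1)
      (.digit, v, ⟨i, a, z, d.map .inl ++ .inr m :: w, e, f.map .inl, y⟩)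
      (.rest, { v with same := v.same && decide (d = f), bit := m },
        ⟨i, a, z, w, f.reverse.map .inl ++ e, [], .inr m :: (d.reverse.map .inl ++ y)⟩) := by
  induction d generalizing e f y v with
  | nil =>
    have h := reach_rest i a z w e (f.map .inl) (.inr m :: y) { v with bit := m }
    have h2 := Reach.head (c := (.digit, v, ⟨i, a, z, .inr m :: w, e, f.map .inl, y⟩)) h
    have hf : decide (f.map (Sum.inl (β := Bool)) = []) = decide ([] = f) := by cases f <;> simp
    rw [hf, List.length_map, ← List.map_reverse] at h2
    simpa using h2
  | cons b d ih =>
    cases f with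
    | nil =>
      have h := ih [] e (.inl b :: y) { v with bit := b, same := false }
      have h2 := Reach.head (c := (.digit, v,
        ⟨i, a, z, .inl b :: (d.map .inl ++ .inr m :: w), e, [], y⟩))
        (Reach.head (c := (.compare, { v with bit := b },
          ⟨i, a, z, d.map .inl ++ .inr m :: w, e, [], .inl b :: y⟩)) h)
      refine Reach.mono ?_ (show 2 * d.length + 0 + 1 + 1 + 1 ≤ _ by simp; omega)
      simpa using h2
    | cons c f =>
      have h := ih f (.inl c :: e) (.inl b :: y)
        { v with bit := b, same := v.same && ((.inl c : Bool ⊕ Bool) == .inl b) }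
      have h2 := Reach.head (c := (.digit, v,
        ⟨i, a, z, .inl b :: (d.map .inl ++ .inr m :: w), e, .inl c :: f.map .inl, y⟩))
        (Reach.head (c := (.compare, { v with bit := b },
          ⟨i, a, z, d.map .inl ++ .inr m :: w, e, .inl c :: f.map .inl, .inl b :: y⟩)) h)
      refine Reach.mono ?_ (show 2 * d.length + f.length + 1 + 1 + 1 ≤ _ by simp; omega)
      have hs : (v.same && ((.inl c : Bool ⊕ Bool) == .inl b) && decide (d = f)) =
          (v.same && decide (b :: d = c :: f)) := by
        have hbc : ((.inl c : Bool ⊕ Bool) == .inl b) = (b == c) := by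
          cases b <;> cases c <;> rfl
        rw [hbc, Bool.eq_iff_iff]
        simp only [Bool.and_eq_true, beq_iff_eq, decide_eq_true_eq, List.cons.injEq, and_assoc]
      rw [← hs]
      simpa using h2

/-- Comparison of a block with all the remaining blocks. -/
theorem reach_pass (B : List (List Bool × Bool)) (d : List Bool) (i a z y : List (Bool ⊕ Bool))
    (v : Vars) (hv : v.same = true) :
    ((∀ b ∈ B, b.1 = d → b.2 = v.value) →
      ∃ v', Reach ((blockSymbols B).length * (2 * d.length + 4) + 1)
        (.digit, v, ⟨i, a, z, blockSymbols B, [], d.map .inl, y⟩)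
        (.back, v', ⟨i, a, z, [], [], d.map .inl, (blockSymbols B).reverse ++ y⟩)) ∧
    ((¬ ∀ b ∈ B, b.1 = d → b.2 = v.value) →
      ∃ v' S, v'.answer = false ∧ Reach ((blockSymbols B).length * (2 * d.length + 4) + 1)
        (.digit, v, ⟨i, a, z, blockSymbols B, [], d.map .inl, y⟩) (.clean .inp, v', S)) := by
  induction B generalizing y v with
  | nil =>
    exact ⟨fun _ => ⟨v, ((Reach.refl 0 _).head).mono (by simp)⟩, fun h => absurd (by simp) h⟩
  | cons b B ih =>
    obtain ⟨d', m⟩ := b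
    have h1 := reach_compare d' d m i a z (blockSymbols B) [] y v
    rw [hv, Bool.true_and, List.append_nil] at h1
    set y' := .inr m :: (d'.reverse.map .inl ++ y) with hy'
    have hlen : (blockSymbols ((d', m) :: B)).length =
        (blockSymbols B).length + (d'.length + 1) := by simp; omega
    -- A block costs `2|d'| + 2|d| + 3` steps, which is less than the share `(|d'| + 1)(2|d| + 4)`
    -- contributed by its `|d'| + 1` symbols.
    have htime : 2 * d'.length + d.length + 1 + (d.length + 1 + 1) +
        ((blockSymbols B).length * (2 * d.length + 4) + 1) ≤
        (blockSymbols ((d', m) :: B)).length * (2 * d.length + 4) + 1 := by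
      rw [hlen]
      nlinarith
    have hstep : step (.rest, { v with same := decide (d' = d), bit := m },
        ⟨i, a, z, blockSymbols B, d.reverse.map .inl, [], y'⟩) =
        (bif decide (d' = d) && v.value != m then .clean .inp else .restore,
          { v with same := decide (d' = d), bit := m, answer := false },
          ⟨i, a, z, blockSymbols B, d.reverse.map .inl, [], y'⟩) := rfl
    by_cases hbad : d' = d ∧ v.value ≠ m
    · refine ⟨fun h => absurd (h (d', m) (by simp) hbad.1).symm hbad.2, fun _ => ?_⟩
      refine ⟨{ v with same := decide (d' = d), bit := m, answer := false },
        ⟨i, a, z, blockSymbols B, d.reverse.map .inl, [], y'⟩, rfl, ?_⟩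
      rw [blockSymbols_cons] at htime ⊢
      refine (h1.trans (Reach.head (Reach.refl 0 _) ?_)).mono
        (le_trans (by omega) htime)
      rw [hstep, decide_eq_true hbad.1, bne_iff_ne.2 hbad.2]
      rfl
    · have h2 := reach_restore i a z (blockSymbols B) (d.reverse.map .inl) [] y'
        { v with same := decide (d' = d), bit := m, answer := false }
      have h3 := Reach.head (c := (.rest, { v with same := decide (d' = d), bit := m },
        ⟨i, a, z, blockSymbols B, d.reverse.map .inl, [], y'⟩)) h2 (by
          rw [hstep]
          have : (decide (d' = d) && v.value != m) = false := by
            rw [Bool.eq_false_iff]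
            simpa using hbad
          rw [this]
          rfl)
      have h4 := h1.trans h3
      simp only [List.length_map, List.length_reverse, ← List.map_reverse, List.reverse_reverse,
        List.append_nil] at h4
      have hiff : (∀ b ∈ (d', m) :: B, b.1 = d → b.2 = v.value) ↔
          ∀ b ∈ B, b.1 = d → b.2 = v.value := by
        rw [List.forall_mem_cons]
        refine and_iff_right fun h => ?_
        by_contra hne
        exact hbad ⟨h, fun h => hne h.symm⟩
      obtain ⟨ih1, ih2⟩ := ih y' { v with same := true, bit := m, answer := false } rfl
      rw [hiff, blockSymbols_cons] at *
      constructor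
      · intro h
        obtain ⟨v', hv'⟩ := ih1 h
        refine ⟨v', ?_⟩
        have h5 := (h4.trans hv').mono htime
        simpa [hy'] using h5
      · intro h
        obtain ⟨v', S, ha, hv'⟩ := ih2 h
        exact ⟨v', S, ha, (h4.trans hv').mono htime⟩

theorem reach_back (i a z w e f y : List (Bool ⊕ Bool)) (v : Vars) :
    Reach (y.length + 1) (.back, v, ⟨i, a, z, w, e, f, y⟩)
      (.clear, v, ⟨i, a, z, y.reverse ++ w, e, f, []⟩) := by
  induction y generalizing w with
  | nil => exact (Reach.refl 0 _).head
  | cons s y ih =>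
    have h := ih (s :: w)
    simp only [List.length_cons, List.reverse_cons, List.append_assoc, List.cons_append,
      List.nil_append]
    exact h.head

theorem reach_clear (i a z w e f y : List (Bool ⊕ Bool)) (v : Vars) :
    Reach (f.length + 1) (.clear, v, ⟨i, a, z, w, e, f, y⟩)
      (.take, v, ⟨i, a, z, w, e, [], y⟩) := by
  induction f with
  | nil => exact (Reach.refl 0 _).head
  | cons s f ih => exact ih.head

open Classical in
/-- The consistency check. -/
theorem reach_consistent (B : List (List Bool × Bool)) (N : ℕ) (hN : (blockSymbols B).length ≤ N)
    (i a z : List (Bool ⊕ Bool)) (v : Vars) :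
    ∃ v' S, v'.answer = decide (ConsistentBlocks B) ∧
      Reach ((B.length + 1) * (N * (2 * N + 4) + 5 * N + 10))
        (.take, v, ⟨i, a, z, blockSymbols B, [], [], []⟩) (.clean .inp, v', S) := by
  induction B generalizing v with
  | nil =>
    refine ⟨{ v with answer := true }, ⟨i, a, z, [], [], [], []⟩, by simp [ConsistentBlocks],
      Reach.mono (t := 0 + 1) (Reach.refl 0 _).head (by simp)⟩
  | cons b B ih =>
    obtain ⟨d, m⟩ := b
    have hlen : (blockSymbols ((d, m) :: B)).length =
        (blockSymbols B).length + (d.length + 1) := by simp; omega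
    rw [hlen] at hN
    have h1 := reach_take d m i a z (blockSymbols B) [] [] [] v
    have h2 := reach_restore i a z (blockSymbols B) (d.reverse.map .inl) [] [] { v with value := m }
    rw [List.append_nil] at h1
    have h3 := h1.trans h2
    simp only [List.length_map, List.length_reverse, ← List.map_reverse, List.reverse_reverse,
      List.append_nil] at h3
    -- The first block is compared with the later ones only, as in the recursive description of
    -- `List.Pairwise`.
    have hpass := reach_pass B d i a z [] { v with value := m, same := true } rfl
    have hmul : (blockSymbols B).length * (2 * d.length + 4) ≤ N * (2 * N + 4) := by
      gcongr <;> omega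
    have hcons : ConsistentBlocks ((d, m) :: B) ↔
        (∀ b ∈ B, b.1 = d → b.2 = m) ∧ ConsistentBlocks B := by
      simp only [ConsistentBlocks, List.pairwise_cons]
    rw [blockSymbols_cons]
    by_cases h : ∀ b ∈ B, b.1 = d → b.2 = m
    · obtain ⟨v₁, hv₁⟩ := hpass.1 h
      have h4 := reach_back i a z [] [] (d.map .inl) ((blockSymbols B).reverse ++ []) v₁
      simp only [List.append_nil, List.reverse_reverse, List.length_reverse] at h4 hv₁
      have h5 := reach_clear i a z (blockSymbols B) [] (d.map .inl) [] v₁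
      obtain ⟨v', S, hv', hr⟩ := ih (by omega) v₁
      refine ⟨v', S, by rw [hv', decide_eq_decide, hcons]; exact (and_iff_right h).symm, ?_⟩
      refine ((((h3.trans hv₁).trans h4).trans h5).trans hr).mono ?_
      simp only [List.length_map, List.length_cons]
      rw [show (B.length + 1 + 1) * (N * (2 * N + 4) + 5 * N + 10) =
        (B.length + 1) * (N * (2 * N + 4) + 5 * N + 10) + (N * (2 * N + 4) + 5 * N + 10) by ring]
      omega
    · obtain ⟨v', S, hv', hr⟩ := hpass.2 h
      refine ⟨v', S, ?_, (h3.trans hr).mono ?_⟩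
      · rw [hv', eq_comm, decide_eq_false_iff_not, hcons]
        exact fun hc => h hc.1
      · refine le_trans ?_ (Nat.le_mul_of_pos_left _ (Nat.succ_pos _))
        omega

theorem length_le_length_blockSymbols (B : List (List Bool × Bool)) :
    B.length ≤ (blockSymbols B).length := by
  induction B with
  | nil => simp
  | cons b B ih => simp; omega

/-- The initial values of the variables. -/
def initVars : Vars := ⟨.start, false, false, false, false⟩

/-- The machine decides the verifier. -/
theorem reach_finish (x u : List Bool) :
    ∃ v, v.answer = verify x u ∧
      Reach ((x.length + u.length + 2) *
          ((x.length + u.length) * (2 * (x.length + u.length) + 4) +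
            5 * (x.length + u.length) + 10) + 10)
        (.read, initVars, ⟨x.map .inl ++ u.map .inr, [], [], [], [], [], []⟩)
        (.finish, v, .empty) := by
  classical
  set N := x.length + u.length with hN
  have h1 := reach_read_word x (u.map .inr) [] [] [] [] [] [] initVars
  rw [List.append_nil] at h1
  obtain ⟨b, a', h2⟩ := reach_read_certificate u x.reverse [] [] [] [] [] initVars
  rw [List.append_nil] at h2
  have h12 := h1.trans h2
  set z := (x.reverse.zip u).reverse with hz
  have hzl : z.length ≤ x.length ∧ z.length ≤ u.length := by simp [hz]
  have hsize : ∀ {t c}, Reach t (.read, initVars,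
      ⟨x.map .inl ++ u.map .inr, [], [], [], [], [], []⟩) c → c.2.2.size ≤ N := fun h =>
    h.size_le.trans (by simp [Regs.size, hN])
  have key : ∃ v S, v.answer = verify x u ∧ Reach (2 * N + 2 + (N + 1) *
      (N * (2 * N + 4) + 5 * N + 10)) (.read, initVars,
        ⟨x.map .inl ++ u.map .inr, [], [], [], [], [], []⟩) (.clean .inp, v, S) := by
    cases hp : parse .start z with
    | none =>
      obtain ⟨v, S, hv, hr⟩ := reach_parse_none (v := { initVars with bit := b })
        [] a' [] [] [] [] hp
      refine ⟨v, S, ?_, (h12.trans hr).mono ?_⟩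
      · rw [hv, eq_comm, verify, decide_eq_false_iff_not, ← hz, hp]
        simp
      · have : 1 * 1 ≤ (N + 1) * (N * (2 * N + 4) + 5 * N + 10) := by gcongr <;> omega
        omega
    | some E =>
      obtain ⟨B, rfl⟩ := parse_eq_blocks hp
      obtain ⟨v₁, hr⟩ := reach_parse_some (v := { initVars with bit := b })
        [] a' [] [] [] [] hp
      have h3 := h12.trans hr
      rw [List.reverse_reverse, List.append_nil] at h3
      -- The blocks lie on a stack in a reachable configuration, and total stack height never grows.
      have hB : (blockSymbols B).length ≤ N := by
        refine le_trans ?_ (hsize h3)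
        simp only [Regs.size]
        omega
      obtain ⟨v, S, hv, hr'⟩ := reach_consistent B N hB [] a' [] v₁
      refine ⟨v, S, ?_, (h3.trans hr').mono ?_⟩
      · rw [hv, verify, decide_eq_decide, ← hz, hp]
        constructor
        · exact fun h => ⟨B, rfl, h⟩
        · rintro ⟨B', hB', h⟩
          rw [Option.some.injEq, List.reverse_inj] at hB'
          rwa [blockSymbols_injective hB']
      · have := (length_le_length_blockSymbols B).trans hB
        have : (B.length + 1) * (N * (2 * N + 4) + 5 * N + 10) ≤
            (N + 1) * (N * (2 * N + 4) + 5 * N + 10) := by gcongr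
        omega
  obtain ⟨v, S, hv, hr⟩ := key
  refine ⟨v, hv, (hr.trans (reach_clean v S)).mono ?_⟩
  have := hsize hr
  simp only at this
  nlinarith

end Verifier

end NonuniformIS

namespace NonuniformIS

/-! ### Implementation of the verifier as a machine in the `TM2` model -/

namespace Verifier

/-- Stack alphabets of the Turing machine: the output stack and the working stacks. -/
abbrev StackAlphabet : Option Reg → Type
  | none => Bool
  | some _ => Bool ⊕ Bool

/-- States of the Turing machine: variables, next label, and symbol to be pushed. -/
abbrev MachineState : Type := Vars × Label × Option (Bool ⊕ Bool)

/-- The program of the Turing machine. -/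
def program : Label → Turing.TM2.Stmt StackAlphabet Label MachineState
  | .finish => .push none (fun v => v.1.answer) (.load (fun _ => (initVars, .read, none)) .halt)
  | l => .pop (some (source l)) (fun v s => ((trans l v.1 s).2.1, (trans l v.1 s).1,
      (trans l v.1 s).2.2))
      (.branch (fun v => v.2.2.isSome)
        (.push (some (target l)) (fun v => v.2.2.getD (.inl false)) (.goto fun v => v.2.1))
        (.goto fun v => v.2.1))

/-- The Turing machine. -/
def machine : Turing.FinTM2 where
  K := Option Reg
  k₀ := some .inp
  k₁ := none
  Γ := StackAlphabet
  Λ := Label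
  main := .read
  σ := MachineState
  initialState := (initVars, .read, none)
  Γk₀Fin := inferInstanceAs (Fintype (Bool ⊕ Bool))
  m := program

/-- The stacks of the Turing machine. -/
def allStacks (S : Regs) (o : List Bool) : ∀ k, List (StackAlphabet k)
  | none => o
  | some r => S.get r

theorem update_allStacks (S : Regs) (o : List Bool) (r : Reg) (L : List (Bool ⊕ Bool)) :
    Function.update (allStacks S o) (some r) L = allStacks (S.set r L) o := by
  funext k
  cases k with
  | none => rfl
  | some r' =>
    by_cases h : r' = r
    · subst h
      rw [Function.update_self]
      exact (Regs.get_set_self _ _ _).symm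
    · rw [Function.update_of_ne (by simpa using h)]
      cases r <;> cases r' <;> first | rfl | exact absurd rfl h

/-- After a pop, `push` and `goto` see only the internal state, so the next label and the symbol to
be pushed are kept there. They are recomputed at each step, whence their old values `j` do not
matter. -/
theorem machine_step {l : Label} (hl : l ≠ .finish) (v : Vars)
    (j : Label × Option (Bool ⊕ Bool)) (S : Regs) :
    ∃ j', Turing.TM2.step program ⟨some l, (v, j), allStacks S []⟩ =
      some ⟨some (step (l, v, S)).1, ((step (l, v, S)).2.1, j'), allStacks (step (l, v, S)).2.2 []⟩ := by
  have hstep : step (l, v, S) = ((trans l v (S.get (source l)).head?).1,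
      (trans l v (S.get (source l)).head?).2.1,
      S.move (source l) (target l) (trans l v (S.get (source l)).head?).2.2) := by
    cases l <;> first | rfl | exact absurd rfl hl
  have hprog : program l = .pop (some (source l)) (fun v s => ((trans l v.1 s).2.1,
      (trans l v.1 s).1, (trans l v.1 s).2.2))
      (.branch (fun v => v.2.2.isSome)
        (.push (some (target l)) (fun v => v.2.2.getD (.inl false)) (.goto fun v => v.2.1))
        (.goto fun v => v.2.1)) := by
    cases l <;> first | rfl | exact absurd rfl hl
  have hs : ∀ (S : Regs) r, allStacks S [] (some r) = S.get r := fun _ _ => rfl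
  rw [hstep]
  simp only [Turing.TM2.step, hprog, Turing.TM2.stepAux, update_allStacks, hs]
  generalize trans l v (S.get (source l)).head? = t
  obtain ⟨l', v', o⟩ := t
  cases o with
  | none => exact ⟨_, rfl⟩
  | some s => exact ⟨_, rfl⟩

/-- `step` idles at `finish` whereas the machine would go on to halt, so the machine is followed
only until its first arrival there; hence `s' ≤ s`. -/
theorem machine_iterate {s : ℕ} {l : Label} {v v' : Vars} {S S' : Regs}
    (h : step^[s] (l, v, S) = (.finish, v', S')) (j : Label × Option (Bool ⊕ Bool)) :
    ∃ s' ≤ s, ∃ j', (flip bind (Turing.TM2.step program))^[s']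
        (some ⟨some l, (v, j), allStacks S []⟩) =
      some ⟨some .finish, (v', j'), allStacks S' []⟩ := by
  induction s generalizing l v S j with
  | zero =>
    simp only [Function.iterate_zero, id_eq, Prod.mk.injEq] at h
    obtain ⟨rfl, rfl, rfl⟩ := h
    exact ⟨0, le_rfl, j, rfl⟩
  | succ s ih =>
    rw [Function.iterate_succ_apply] at h
    by_cases hl : l = .finish
    · subst hl
      obtain ⟨s', hs', hj⟩ := ih h j
      exact ⟨s', hs'.trans (Nat.le_succ s), hj⟩
    · obtain ⟨j₁, h₁⟩ := machine_step hl v j S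
      generalize step (l, v, S) = c at h h₁
      obtain ⟨l₁, v₁, S₁⟩ := c
      obtain ⟨s', hs', j', hj'⟩ := ih h j₁
      refine ⟨s' + 1, Nat.succ_le_succ hs', j', ?_⟩
      rw [Function.iterate_succ_apply, ← hj', ← h₁]
      rfl

theorem initList_machine (w : List (Bool ⊕ Bool)) :
    Turing.initList machine w =
      ⟨some .read, (initVars, .read, none), allStacks ⟨w, [], [], [], [], [], []⟩ []⟩ := by
  refine congrArg (Turing.TM2.Cfg.mk _ _) (funext fun k => ?_)
  cases k with
  | none => rfl
  | some r => cases r <;> rfl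

theorem haltList_machine (b : Bool) :
    Turing.haltList machine [b] = ⟨none, (initVars, .read, none), allStacks .empty [b]⟩ := by
  refine congrArg (Turing.TM2.Cfg.mk _ _) (funext fun k => ?_)
  cases k with
  | none => rfl
  | some r => cases r <;> rfl

/-- `haltList` requires the initial internal state and empty stacks apart from the output; this is
why the program clears its stacks and resets its variables before halting. -/
theorem machine_finish (v : Vars) (j : Label × Option (Bool ⊕ Bool)) :
    Turing.TM2.step program ⟨some .finish, (v, j), allStacks .empty []⟩ =
      some ⟨none, (initVars, .read, none), allStacks .empty [v.answer]⟩ := by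
  have h : Function.update (allStacks .empty []) none [v.answer] = allStacks .empty [v.answer] := by
    funext k
    cases k <;> rfl
  rw [← h]
  rfl

theorem machine_outputs (x u : List Bool) :
    ∃ s ≤ (x.length + u.length + 2) *
          ((x.length + u.length) * (2 * (x.length + u.length) + 4) +
            5 * (x.length + u.length) + 10) + 11,
      (flip bind machine.step)^[s]
        (some (Turing.initList machine (x.map .inl ++ u.map .inr))) =
      some (Turing.haltList machine [verify x u]) := by
  obtain ⟨v, hv, s, hs, h⟩ := reach_finish x u
  obtain ⟨s', hs', j, hj⟩ := machine_iterate h (.read, none)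
  -- The extra step executes the statement at `finish`, which raises the constant from `10` to `11`.
  refine ⟨s' + 1, by omega, ?_⟩
  rw [haltList_machine, Function.iterate_succ_apply', ← hv]
  refine Eq.trans ?_ (machine_finish v j)
  exact congrArg (flip bind (Turing.TM2.step program)) ((congrArg (fun c =>
    (flip bind (Turing.TM2.step program))^[s'] (some c)) (initList_machine _)).trans hj)

end Verifier

open Polynomial in
theorem polyTimeVerifier_verify : PolyTimeVerifier verify := by
  refine ⟨⟨⟨Verifier.machine, Equiv.refl _, Equiv.refl _⟩,
    (X + 2) * (X * (2 * X + 4) + 5 * X + 10) + 11, fun xu => ?_⟩⟩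
  have h := Verifier.machine_outputs xu.1 xu.2
  refine ⟨⟨h.choose, ?_⟩, ?_⟩
  · have he : ((Computability.encodingProd (Computability.encodingList Bool)
        (Computability.encodingList Bool)).encode xu).map (Equiv.refl (Bool ⊕ Bool)).invFun =
        xu.1.map .inl ++ xu.2.map .inr := by
      simp [Computability.encodingProd, Computability.encodingList]
    refine Eq.trans (congrArg (fun w => (flip bind Verifier.machine.step)^[h.choose]
      (some (Turing.initList Verifier.machine w))) he) h.choose_spec.2
  · refine h.choose_spec.1.trans (le_of_eq ?_)
    simp [Computability.encodingProd, Computability.encodingList]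

theorem threeSAT_mem_NP : threeSAT ∈ NP :=
  ⟨fun n => n, ⟨Polynomial.X, fun n => by simp⟩, verify, polyTimeVerifier_verify,
    mem_threeSAT_iff_verify⟩

end NonuniformIS

theorem mainTheorem5 (α : NonuniformIS.DisjNumbering) :
    (NonuniformIS.threeSATC α ∉ NonuniformIS.PLIS ↔
        NonuniformIS.threeSAT ∉ NonuniformIS.PPoly) ∧
      (NonuniformIS.threeSATC α ∉ NonuniformIS.PLIS ↔
        ¬ NonuniformIS.NP ⊆ NonuniformIS.PPoly) := by
  have h1 := NonuniformIS.NP_subset_PPoly (α := α)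
  have h2 := NonuniformIS.threeSATC_mem_PLIS α
  have h3 : NonuniformIS.NP ⊆ NonuniformIS.PPoly → NonuniformIS.threeSAT ∈ NonuniformIS.PPoly :=
    fun h => h NonuniformIS.threeSAT_mem_NP
  tauto
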